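/- Let $n\ge 0$ be an integer and $j=n/2$. Let $\varphi_j:SU(2)\to U(n+1)$ be the irreducible representation of $SU(2)$ on $\mathbb C^{n+1}$, realized as the $n$-th symmetric power of the standard representation on $\mathbb C^2$ in the orthonormal basis $\sqrt{\binom nk}\,z_1^{n-k}z_2^{k}$, $k=0,\dots,n$. Let $SU(2)$ act on $M_{\mathbb C}(n+1)$ by $P^g=\varphi_j(g)P\varphi_j(g^{-1})$ and on functions $F:S^2\to\mathbb C$ by $F^g(\mathbf n)=F(\psi(g)^{-1}\mathbf n)$, where $\psi:SU(2)\to SO(3)$ is the covering homomorphism given by $g(\mathbf x\cdot\sigma)g^{-1}=(\psi(g)\mathbf x)\cdot\sigma$ with the Pauli matrices $\sigma$ (both actions factor through $SO(3)$). A \emph{spin-$j$ symbol correspondence} is a map $P\mapsto W_P$ from $M_{\mathbb C}(n+1)$ to smooth functions $S^2\to\mathbb C$ such that: (i) $W$ is $\mathbb C$-linear and injective; (ii) $W_{P^g}=(W_P)^g$ for all $g$; (iii) $W_{P^*}=\overline{W_P}$; (iv) $\frac1{4\pi}\int_{S^2}W_P\,dS=\frac1{n+1}\operatorname{tr}P$.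 Let $\beta_{l,m}=\sqrt{(l+m)(l-m+1)}$. Let $J_-\in M_{\mathbb C}(n+1)$ be the matrix whose only nonzero entries are $(J_-)_{b+1,b}=\sqrt{(n-b)(b+1)}$, $0\le b<n$ (indices $0,\dots,n$), and $J_+=J_-^T$. For $0\le l\le n$ define $e^j(l,m)$, $-l\le m\le l$, by $$e^j(l,l)=\frac{(-1)^l}{\|J_+^l\|}J_+^l,\qquad e^j(l,m-1)=\frac1{\beta_{l,m}}[J_-,e^j(l,m)],$$ with $\|A\|^2=\operatorname{tr}(A^*A)$, and define the spherical harmonics $Y_l^m$ on $S^2$ by $$Y_l^l=\frac{(-1)^l}{\lambda_l}(x+iy)^l,\quad \lambda_l=\frac{l!\,2^l}{\sqrt{(2l+1)!}},\qquad Y_l^{m-1}=\frac1{\beta_{l,m}}\big((x-iy)\partial_z-z(\partial_x-i\partial_y)\big)Y_l^m .$$ Let $M_{\mathbb C}(\varphi_l)$ be the span of the $e^j(l,m)$ and $Poly(\varphi_l)$ the span of the $Y_l^m$, $-l\le m\le l$. \textbf{Theorem.} (a) $M_{\mathbb C}(n+1)=\bigoplus_{l=0}^n M_{\mathbb C}(\varphi_l)$,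 and for each $0\le l\le n$ both $M_{\mathbb C}(\varphi_l)$ and $Poly(\varphi_l)$ are irreducible subrepresentations of dimension $2l+1$. (b) The moduli space of all spin-$j$ symbol correspondences is $(\mathbb R^*)^n$, $\mathbb R^*=\mathbb R\setminus\{0\}$: there is a homeomorphism $W\mapsto(c_1,\dots,c_n)$ from the set of all spin-$j$ symbol correspondences (with the topology of pointwise convergence) onto $(\mathbb R^*)^n$ such that, with $c_0=1$, $$W\big(\sqrt{n+1}\,e^j(l,m)\big)=c_l\,Y_l^m\qquad\text{for all }-l\le m\le l\le n .$$ -/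

import Mathlib

open scoped ContDiff Manifold ComplexConjugate

noncomputable section

namespace SpinSystem

/-- The group `SU(2)`. -/
abbrev SU2 : Type := Matrix.specialUnitaryGroup (Fin 2) ℂ

/-- The group `SO(3)`. -/
abbrev SO3 : Type := Matrix.specialOrthogonalGroup (Fin 3) ℝ

/-- The unit sphere of Euclidean three-space. -/
abbrev S2 : Type := Metric.sphere (0 : EuclideanSpace ℝ (Fin 3)) 1

instance finrankThree : Fact (Module.finrank ℝ (EuclideanSpace ℝ (Fin 3)) = 2 + 1) :=
  ⟨by simp⟩

/-- The space `M_ℂ(n+1)` of operators of the spin-`n/2` system, in the standard basis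
`u(j,j), u(j,j-1), …, u(j,-j)` (indexed by `0, 1, …, n`). -/
abbrev Op (n : ℕ) : Type := Matrix (Fin (n + 1)) (Fin (n + 1)) ℂ

/-! ### The spin-`n/2` representation of `SU(2)` -/

/-- The image of `z₁ ^ (n - b) * z₂ ^ b` under the substitution
`z₁ ↦ g₀₀ z₁ + g₁₀ z₂`, `z₂ ↦ g₀₁ z₁ + g₁₁ z₂`, written inhomogeneously: the coefficient of
`X ^ a` is the coefficient of `z₁ ^ (n - a) * z₂ ^ a`. -/
def symPoly (n : ℕ) (g : Matrix (Fin 2) (Fin 2) ℂ) (b : ℕ) : Polynomial ℂ :=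
  (Polynomial.C (g 0 0) + Polynomial.C (g 1 0) * Polynomial.X) ^ (n - b) *
    (Polynomial.C (g 0 1) + Polynomial.C (g 1 1) * Polynomial.X) ^ b

/-- The matrix of the `n`-th symmetric power of `g` in the orthonormal basis
`√(n choose k) z₁ ^ (n - k) * z₂ ^ k`, `k = 0, …, n`. -/
def symMatrix (n : ℕ) (g : Matrix (Fin 2) (Fin 2) ℂ) : Op n :=
  Matrix.of fun a b =>
    ((√(n.choose b : ℝ) / √(n.choose a : ℝ) : ℝ) : ℂ) * (symPoly n g b).coeff a

lemma symPoly_natDegree_le (n : ℕ) (g : Matrix (Fin 2) (Fin 2) ℂ) (b : Fin (n + 1)) :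
    (symPoly n g b).natDegree ≤ n := by
  have h1 : ∀ u v : ℂ, (Polynomial.C u + Polynomial.C v * Polynomial.X).natDegree ≤ 1 := by
    intro u v
    rw [add_comm]
    exact Polynomial.natDegree_linear_le
  have hb := b.is_le
  refine Polynomial.natDegree_mul_le.trans ?_
  refine (Nat.add_le_add (Polynomial.natDegree_pow_le_of_le _ (h1 _ _))
    (Polynomial.natDegree_pow_le_of_le _ (h1 _ _))).trans ?_
  omega

lemma symPoly_mul (n : ℕ) (g h : Matrix (Fin 2) (Fin 2) ℂ) (b : Fin (n + 1))
    (hg : g 0 0 ≠ 0 ∨ g 1 0 ≠ 0) :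
    symPoly n (g * h) b =
      ∑ c : Fin (n + 1), Polynomial.C ((symPoly n h b).coeff c) * symPoly n g c := by
  set A : Polynomial ℂ := Polynomial.C (g 0 0) + Polynomial.C (g 1 0) * Polynomial.X with hA
  have hA0 : A ≠ 0 := by
    intro h0
    have e0 := congrArg (fun p => Polynomial.coeff p 0) h0
    have e1 := congrArg (fun p => Polynomial.coeff p 1) h0
    simp [hA] at e0 e1
    rcases hg with hg | hg
    · exact hg e0
    · exact hg e1
  refine Polynomial.eq_of_infinite_eval_eq _ _ ?_
  have hfin : {x : ℂ | A.IsRoot x}.Finite := Polynomial.finite_setOfPred_isRoot hA0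
  refine (hfin.infinite_compl).mono ?_
  intro x hx
  have hx' : g 0 0 + g 1 0 * x ≠ 0 := by
    intro h0
    exact hx (by simp [Polynomial.IsRoot, hA, h0])
  have hb := b.is_le
  set u : ℂ := g 0 0 + g 1 0 * x with hu
  set v : ℂ := g 0 1 + g 1 1 * x with hv
  have key : (symPoly n h b).eval (v / u) =
      ∑ c : Fin (n + 1), (symPoly n h b).coeff c * (v / u) ^ (c : ℕ) := by
    rw [Polynomial.eval_eq_sum_range' (Nat.lt_succ_of_le (symPoly_natDegree_le n h b)),
      Finset.sum_range]
  have l1 : (symPoly n (g * h) b).eval x = u ^ n * (symPoly n h b).eval (v / u) := by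
    have hn : u ^ n = u ^ (n - (b : ℕ)) * u ^ (b : ℕ) := by
      rw [← pow_add, Nat.sub_add_cancel hb]
    rw [hn]
    simp only [symPoly, Matrix.mul_apply, Fin.sum_univ_two, Polynomial.eval_mul,
      Polynomial.eval_pow, Polynomial.eval_add, Polynomial.eval_C, Polynomial.eval_X]
    rw [mul_mul_mul_comm, ← mul_pow, ← mul_pow]
    congr 2
    · field_simp
      rw [hu, hv]; ring
    · field_simp
      rw [hu, hv]; ring
  show (symPoly n (g * h) b).eval x = Polynomial.eval x _
  rw [l1, key, Finset.mul_sum, Polynomial.eval_finsetSum]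
  refine Finset.sum_congr rfl fun c _ => ?_
  have hc := c.is_le
  have hn : u ^ n = u ^ (n - (c : ℕ)) * u ^ (c : ℕ) := by
    rw [← pow_add, Nat.sub_add_cancel hc]
  rw [hn]
  simp only [symPoly, Polynomial.eval_mul,
      Polynomial.eval_pow, Polynomial.eval_add, Polynomial.eval_C, Polynomial.eval_X]
  rw [← hu, ← hv, div_pow]
  field_simp

lemma symMatrix_mul (n : ℕ) (g h : Matrix (Fin 2) (Fin 2) ℂ)
    (hg : g 0 0 ≠ 0 ∨ g 1 0 ≠ 0) :
    symMatrix n (g * h) = symMatrix n g * symMatrix n h := by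
  ext a b
  simp only [symMatrix, Matrix.mul_apply, Matrix.of_apply]
  rw [symPoly_mul n g h b hg, Polynomial.finsetSum_coeff, Finset.mul_sum]
  refine Finset.sum_congr rfl fun c _ => ?_
  have hc : (√(n.choose c : ℝ) : ℝ) ≠ 0 := by
    have : 0 < n.choose c := Nat.choose_pos c.is_le
    positivity
  rw [Polynomial.coeff_C_mul]
  have : (√(n.choose b : ℝ) / √(n.choose a : ℝ) : ℝ) =
      (√(n.choose c : ℝ) / √(n.choose a : ℝ)) * (√(n.choose b : ℝ) / √(n.choose c : ℝ)) := by
    field_simp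
  rw [this, Complex.ofReal_mul]
  ring

lemma symMatrix_one (n : ℕ) : symMatrix n 1 = 1 := by
  ext a b
  have ha : (√(n.choose a : ℝ) : ℝ) ≠ 0 := by
    have : 0 < n.choose a := Nat.choose_pos a.is_le
    positivity
  simp only [symMatrix, symPoly, Matrix.of_apply, Matrix.one_apply]
  by_cases h : a = b
  · subst h
    simp [Polynomial.coeff_X_pow, div_self ha]
  · have h' : (a : ℕ) ≠ b := fun e => h (Fin.ext e)
    simp [Polynomial.coeff_X_pow, h, h']

lemma su2_entries (g : SU2) :
    g.1 0 1 = -conj (g.1 1 0) ∧ g.1 1 1 = conj (g.1 0 0) ∧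
      Complex.normSq (g.1 0 0) + Complex.normSq (g.1 1 0) = 1 := by
  obtain ⟨A, hA⟩ := g
  rw [Matrix.mem_specialUnitaryGroup_iff, Matrix.mem_unitaryGroup_iff'] at hA
  obtain ⟨hU, hd⟩ := hA
  have hadj : star A = A.adjugate := by
    have h1 : A * A.adjugate = 1 := by rw [Matrix.mul_adjugate, hd, one_smul]
    calc star A = star A * (A * A.adjugate) := by rw [h1, mul_one]
      _ = A.adjugate := by rw [← mul_assoc, hU, one_mul]
  rw [Matrix.adjugate_fin_two] at hadj
  have e00 := congrFun (congrFun hadj 0) 0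
  have e01 := congrFun (congrFun hadj 0) 1
  have e := congrFun (congrFun hU 0) 0
  simp [Matrix.star_apply] at e00 e01
  simp [Matrix.mul_apply, Matrix.star_apply, Fin.sum_univ_two] at e
  refine ⟨?_, ?_, ?_⟩
  · simp [e01]
  · exact e00.symm
  · have := congrArg Complex.re e
    simpa [Complex.normSq_apply] using this

/-- The irreducible unitary representation `φ_j` of `SU(2)`, `j = n/2`, as matrices in the
standard basis. -/
def spinRep (n : ℕ) : SU2 →* Op n where
  toFun g := symMatrix n g.1
  map_one' := symMatrix_one n
  map_mul' g h := by
    refine symMatrix_mul n g.1 h.1 ?_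
    by_contra hc
    push Not at hc
    have := (su2_entries g).2.2
    simp [hc.1, hc.2] at this

/-- The conjugation action `P ↦ P^g = φ_j(g) P φ_j(g⁻¹)` of `SU(2)` on operators. -/
def opRep (n : ℕ) : Representation ℂ SU2 (Op n) where
  toFun g := LinearMap.mulLeft ℂ (spinRep n g) ∘ₗ LinearMap.mulRight ℂ (spinRep n g⁻¹)
  map_one' := by
    ext1 P
    simp
  map_mul' g h := by
    refine LinearMap.ext fun P => ?_
    simp [mul_assoc]

/-! ### The covering `SU(2) → SO(3)` and the action on functions on the sphere -/

/-- The Pauli matrices. -/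
def pauli : Fin 3 → Matrix (Fin 2) (Fin 2) ℂ :=
  ![!![0, 1; 1, 0], !![0, -Complex.I; Complex.I, 0], !![1, 0; 0, -1]]

/-- The matrix `R` with `g (x · σ) g⁻¹ = (R x) · σ`; its entries are
`R a b = tr (σ_a g σ_b g*) / 2`. -/
def rotMatrix (g : Matrix (Fin 2) (Fin 2) ℂ) : Matrix (Fin 3) (Fin 3) ℝ :=
  Matrix.of fun a b => (Matrix.trace (pauli a * g * pauli b * star g)).re / 2

lemma rotMatrix_eq (g : SU2) : rotMatrix g.1 =
    !![(g.1 0 0).re ^ 2 - (g.1 0 0).im ^ 2 - (g.1 1 0).re ^ 2 + (g.1 1 0).im ^ 2,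
        2 * ((g.1 0 0).re * (g.1 0 0).im - (g.1 1 0).re * (g.1 1 0).im),
        2 * ((g.1 0 0).re * (g.1 1 0).re + (g.1 0 0).im * (g.1 1 0).im);
       -2 * ((g.1 0 0).re * (g.1 0 0).im + (g.1 1 0).re * (g.1 1 0).im),
        (g.1 0 0).re ^ 2 - (g.1 0 0).im ^ 2 + (g.1 1 0).re ^ 2 - (g.1 1 0).im ^ 2,
        2 * ((g.1 0 0).re * (g.1 1 0).im - (g.1 0 0).im * (g.1 1 0).re);
       -2 * ((g.1 0 0).re * (g.1 1 0).re - (g.1 0 0).im * (g.1 1 0).im),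
        -2 * ((g.1 0 0).re * (g.1 1 0).im + (g.1 0 0).im * (g.1 1 0).re),
        (g.1 0 0).re ^ 2 + (g.1 0 0).im ^ 2 - (g.1 1 0).re ^ 2 - (g.1 1 0).im ^ 2] := by
  obtain ⟨h1, h2, -⟩ := su2_entries g
  ext a b
  fin_cases a <;> fin_cases b <;>
    simp [rotMatrix, pauli, Matrix.trace, Matrix.mul_apply, Fin.sum_univ_two,
      Matrix.star_apply, h1, h2] <;> ring

lemma rotMatrix_mem (g : SU2) : rotMatrix g.1 ∈ Matrix.specialOrthogonalGroup (Fin 3) ℝ := by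
  have h := (su2_entries g).2.2
  rw [Complex.normSq_apply, Complex.normSq_apply] at h
  rw [rotMatrix_eq, Matrix.mem_specialOrthogonalGroup_iff, Matrix.mem_orthogonalGroup_iff]
  generalize (g.1 0 0).re = a at *
  generalize (g.1 0 0).im = b at *
  generalize (g.1 1 0).re = c at *
  generalize (g.1 1 0).im = d at *
  have h2 : (a * a + b * b + (c * c + d * d)) ^ 2 = 1 := by rw [h]; norm_num
  have h3 : (a * a + b * b + (c * c + d * d)) ^ 3 = 1 := by rw [h]; norm_num
  constructor
  · ext i k
    fin_cases i <;> fin_cases k <;>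
      simp [Matrix.mul_apply, Fin.sum_univ_three] <;>
      first
      | ring1
      | linear_combination h2
  · rw [Matrix.det_fin_three]
    simp
    linear_combination h3

lemma rotMatrix_mul (g h : SU2) : rotMatrix (g * h).1 = rotMatrix g.1 * rotMatrix h.1 := by
  obtain ⟨h1, h2, -⟩ := su2_entries g
  rw [rotMatrix_eq, rotMatrix_eq, rotMatrix_eq]
  have e0 : (g * h).1 0 0 = g.1 0 0 * h.1 0 0 - conj (g.1 1 0) * h.1 1 0 := by
    change (g.1 * h.1) 0 0 = _
    rw [Matrix.mul_apply, Fin.sum_univ_two, h1]; ring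
  have e1 : (g * h).1 1 0 = g.1 1 0 * h.1 0 0 + conj (g.1 0 0) * h.1 1 0 := by
    change (g.1 * h.1) 1 0 = _
    rw [Matrix.mul_apply, Fin.sum_univ_two, h2]
  rw [e0, e1]
  ext i k
  fin_cases i <;> fin_cases k <;>
    simp [Matrix.mul_apply, Fin.sum_univ_three] <;> ring

/-- The covering homomorphism `ψ : SU(2) → SO(3)`. -/
def cover : SU2 →* SO3 where
  toFun g := ⟨rotMatrix g.1, rotMatrix_mem g⟩
  map_one' := by
    refine Subtype.ext ?_
    change rotMatrix (1 : SU2).1 = 1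
    rw [rotMatrix_eq]
    ext i k
    fin_cases i <;> fin_cases k <;> simp
  map_mul' g h := Subtype.ext (rotMatrix_mul g h)

lemma rotate_mem (R : SO3) (x : S2) :
    WithLp.toLp 2 (R.1.mulVec x.1.ofLp) ∈ Metric.sphere (0 : EuclideanSpace ℝ (Fin 3)) 1 := by
  have hR := (Matrix.mem_specialOrthogonalGroup_iff.1 R.2).1
  rw [Matrix.mem_orthogonalGroup_iff'] at hR
  have hx : x.1.ofLp ⬝ᵥ x.1.ofLp = 1 := by
    have := x.2
    rw [mem_sphere_zero_iff_norm, EuclideanSpace.norm_eq, Real.sqrt_eq_one] at this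
    simpa [dotProduct, sq] using this
  rw [mem_sphere_zero_iff_norm, EuclideanSpace.norm_eq, Real.sqrt_eq_one]
  have : (R.1.mulVec x.1.ofLp) ⬝ᵥ (R.1.mulVec x.1.ofLp) = 1 := by
    rw [Matrix.dotProduct_mulVec, Matrix.vecMul_mulVec]
    have h' : R.1.transpose * R.1 = 1 := hR
    rw [← Matrix.dotProduct_mulVec, h', Matrix.one_mulVec, hx]
  simpa [dotProduct, sq] using this

/-- The rotation action of `SO(3)` on the sphere. -/
def rotate (R : SO3) (x : S2) : S2 := ⟨WithLp.toLp 2 (R.1.mulVec x.1.ofLp), rotate_mem R x⟩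

/-- The action `F ↦ F^g`, `F^g(x) = F(g⁻¹ x)` on functions on the sphere; `SU(2)` acts through
its covering homomorphism onto `SO(3)`. -/
def fnRep : Representation ℂ SU2 (S2 → ℂ) where
  toFun g :=
    { toFun := fun F x => F (rotate (cover g)⁻¹ x)
      map_add' := fun _ _ => rfl
      map_smul' := fun _ _ => rfl }
  map_one' := by
    refine LinearMap.ext fun F => funext fun x => ?_
    refine congrArg F (Subtype.ext ?_)
    simp [rotate]
  map_mul' g h := by
    refine LinearMap.ext fun F => funext fun x => ?_
    refine congrArg F (Subtype.ext ?_)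
    simp [rotate, Matrix.mulVec_mulVec]

/-! ### Symbol correspondences -/

/-- A symbol correspondence for the spin-`n/2` system. The surface measure of the sphere is
`volume.toSphere`, of total mass `4π`. -/
structure SymbolCorrespondence (n : ℕ) where
  toLin : Op n →ₗ[ℂ] (S2 → ℂ)
  smooth : ∀ P, ContMDiff (𝓡 2) 𝓘(ℝ, ℂ) ∞ (toLin P)
  injective : Function.Injective toLin
  equivariant : ∀ (g : SU2) (P : Op n), toLin (opRep n g P) = fnRep g (toLin P)
  real : ∀ (P : Op n) (x : S2), toLin P.conjTranspose x = conj (toLin P x)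
  normalized : ∀ P : Op n,
    (1 / (4 * Real.pi) : ℂ) *
        ∫ x, toLin P x ∂(MeasureTheory.volume : MeasureTheory.Measure
          (EuclideanSpace ℝ (Fin 3))).toSphere =
      (1 / (n + 1) : ℂ) * P.trace

/-- Symbol correspondences carry the topology of pointwise convergence. -/
instance symbolTopology (n : ℕ) : TopologicalSpace (SymbolCorrespondence n) :=
  TopologicalSpace.induced (fun W => (fun P x => W.toLin P x : Op n → S2 → ℂ)) inferInstance

/-! ### The coupled standard basis of the operators -/

/-- The lowering operator `J₋`, with entries `√((n - b)(b + 1))` just below the diagonal. -/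
def Jminus (n : ℕ) : Op n :=
  Matrix.of fun a b =>
    if (a : ℕ) = (b : ℕ) + 1 then ((√(((n : ℝ) - (b : ℕ)) * ((b : ℕ) + 1)) : ℝ) : ℂ) else 0

/-- The raising operator `J₊`, the transpose of `J₋`. -/
def Jplus (n : ℕ) : Op n := (Jminus n).transpose

/-- `μ_l`, the Hilbert–Schmidt norm of `J₊ ^ l`. -/
def opNorm (n l : ℕ) : ℝ := √((Jminus n ^ l * Jplus n ^ l).trace.re)

/-- `β_{l,m} = √((l + m)(l - m + 1))`. -/
def beta (l : ℕ) (m : ℤ) : ℝ := √(((l : ℝ) + m) * (l - m + 1))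

/-- `e(l, l - k)`, by recursion on `k`. -/
def coupledAux (n l : ℕ) : ℕ → Op n
  | 0 => (((-1) ^ l / opNorm n l : ℝ) : ℂ) • Jplus n ^ l
  | k + 1 => ((1 / beta l ((l : ℤ) - k) : ℝ) : ℂ) •
      (Jminus n * coupledAux n l k - coupledAux n l k * Jminus n)

/-- The coupled standard basis `e(l, m)`, `0 ≤ l ≤ n`, `-l ≤ m ≤ l`. -/
def coupled (n l : ℕ) (m : ℤ) : Op n := coupledAux n l ((l : ℤ) - m).toNat

/-- The summand of the operator space with standard basis `e(l, m)`, `-l ≤ m ≤ l`. -/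
def opSummand (n l : ℕ) : Submodule ℂ (Op n) :=
  Submodule.span ℂ {A | ∃ m : ℤ, |m| ≤ l ∧ A = coupled n l m}

/-! ### Spherical harmonics -/

/-- The lowering operator `J₋ = J₁ - i J₂` on polynomials in `x, y, z`, where
`J₁ = i (z ∂_y - y ∂_z)` and `J₂ = i (x ∂_z - z ∂_x)` generate the action `F ↦ F^g`; that is,
`J₋ = (x - i y) ∂_z - z (∂_x - i ∂_y)`. -/
def polyLower (p : MvPolynomial (Fin 3) ℂ) : MvPolynomial (Fin 3) ℂ :=
  (MvPolynomial.X 0 - MvPolynomial.C Complex.I * MvPolynomial.X 1) * MvPolynomial.pderiv 2 p -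
    MvPolynomial.X 2 *
      (MvPolynomial.pderiv 0 p - MvPolynomial.C Complex.I * MvPolynomial.pderiv 1 p)

/-- `λ_l = l! 2 ^ l / √((2 l + 1)!)`, the norm of `(x + i y) ^ l` in `L²` of the sphere with
normalized surface measure. -/
def harmNorm (l : ℕ) : ℝ := l.factorial * 2 ^ l / √((2 * l + 1).factorial : ℝ)

/-- A polynomial representing `Y_{l, l - k}`, by recursion on `k`. -/
def harmAux (l : ℕ) : ℕ → MvPolynomial (Fin 3) ℂ
  | 0 => MvPolynomial.C (((-1) ^ l / harmNorm l : ℝ) : ℂ) *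
      (MvPolynomial.X 0 + MvPolynomial.C Complex.I * MvPolynomial.X 1) ^ l
  | k + 1 => MvPolynomial.C ((1 / beta l ((l : ℤ) - k) : ℝ) : ℂ) * polyLower (harmAux l k)

/-- The spherical harmonic `Y_{l, m}`, `-l ≤ m ≤ l`, as a function on the sphere. -/
def sphHarm (l : ℕ) (m : ℤ) : S2 → ℂ := fun x =>
  MvPolynomial.eval (fun i => ((x.1 i : ℝ) : ℂ)) (harmAux l ((l : ℤ) - m).toNat)

/-- The space of spherical harmonics of degree `l`, with standard basis `Y_{l, m}`. -/
def harmSummand (l : ℕ) : Submodule ℂ (S2 → ℂ) :=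
  Submodule.span ℂ {F | ∃ m : ℤ, |m| ≤ l ∧ F = sphHarm l m}

/-- `S` is an irreducible subrepresentation of `ρ`. -/
def IsIrreducibleSub {V : Type*} [AddCommGroup V] [Module ℂ V] (ρ : Representation ℂ SU2 V)
    (S : Submodule ℂ V) : Prop :=
  ∃ T : Subrepresentation ρ, T.toSubmodule = S ∧ T.toRepresentation.IsIrreducible

end SpinSystem

end

/-!
The coherent vector of `(z, w)`, the `N`-th symmetric power of a vector of `ℂ²`, is carried by
`g` to the coherent vector of `g (z, w)`, and the vectors `(1, t)` already span. For this reason a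
linear map out of `ℂ^(2 l + 1)` is equivariant as soon as its values at coherent vectors transform
by substitution. In the bases `e(l, m)` and `Y_{l, m}` these values are multiples of
`(z² J₊ - 2 z w J₃ - w² J₋) ^ l` and `(z² (x + i y) - 2 z w z' - w² (x - i y)) ^ l`, with `z'` the
third coordinate on the sphere: both bases are lowering sequences, so their generating functions
are powers of those of degree one. Hence both families span copies of the spin-`l` representation.

That representation is irreducible: an invariant subspace is stable under a diagonal element with
distinct eigenvalues, so it is spanned by basis vectors, and an element all of whose entries are
nonzero connects each basis vector with the first one. The copies for different `l` have different
dimensions, so they are independent, and `∑_{l ≤ n} (2 l + 1) = (n + 1)²` shows that they fill the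
operator space.

An equivariant map into functions on the sphere is determined by its values at the north pole, where
only the weight-zero vector contributes. So a symbol correspondence multiplies `Y_{l, m}` by a
scalar `c_l`: it is nonzero by injectivity, real because the weight-zero operators are Hermitian,
and `c_0 = 1` by the normalization, since traces and mean values vanish for `l > 0`. Conversely, all
nonzero real scalars `c_1, …, c_n` occur.
-/

noncomputable section

namespace SpinSystem

/-! ### Irreducible representations -/

section Irreducible

open Representation
open scoped MonoidAlgebra

lemma iSupIndep_of_isSimpleModule {R M ι : Type*} [Ring R] [AddCommGroup M] [Module R M]
    (N : ι → Submodule R M) [∀ i, IsSimpleModule R (N i)]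
    (hN : Pairwise fun i j => IsEmpty (N i ≃ₗ[R] N j)) : iSupIndep N := by
  refine iSupIndep_def'.2 fun i => ?_
  refine (isSimpleModule_iff_isAtom.1 inferInstance).not_le_iff_disjoint.1 fun hle => ?_
  have hsimple : ∀ m : N '' {j | j ≠ i}, IsSimpleModule R m := by
    rintro ⟨_, j, -, rfl⟩
    infer_instance
  obtain ⟨_, ⟨j, hj, rfl⟩, e⟩ := (N i).linearEquiv_of_le_sSup _ hle
  exact not_isEmpty_iff.2 e (hN (Ne.symm hj))

lemma lsum_injective_of_iSupIndep {R M ι : Type*} [Fintype ι] [DecidableEq ι] [CommRing R]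
    [AddCommGroup M] [Module R M] {V : ι → Type*} [∀ i, AddCommGroup (V i)] [∀ i, Module R (V i)]
    {f : ∀ i, V i →ₗ[R] M} (hf : ∀ i, Function.Injective (f i))
    (hind : iSupIndep fun i => LinearMap.range (f i)) :
    Function.Injective (LinearMap.lsum R V R f) := by
  refine LinearMap.ker_eq_bot.1 (LinearMap.ker_eq_bot'.2 fun v hv => funext fun i => ?_)
  have hzero : f i (v i) = 0 :=
    (iSupIndep_iff_finsetSum_eq_zero_imp_eq_zero _).1 hind Finset.univ (fun i => f i (v i))
      (fun i _ => ⟨v i, rfl⟩) (by simpa using hv) i (Finset.mem_univ i)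
  exact hf i (hzero.trans (map_zero (f i)).symm)

variable {k G V W : Type*} [Field k] [Monoid G] [AddCommGroup V] [Module k V]
  [AddCommGroup W] [Module k W] {σ : Representation k G V} {ρ : Representation k G W}

lemma intertwiningMap_injective_of_ne_zero [σ.IsIrreducible] {f : IntertwiningMap σ ρ}
    (hf : f ≠ 0) : Function.Injective f.toLinearMap :=
  (IsIrreducible.injective_or_eq_zero f).resolve_right hf

lemma finrank_range_intertwiningMap [σ.IsIrreducible] {f : IntertwiningMap σ ρ} (hf : f ≠ 0) :
    Module.finrank k (LinearMap.range f.toLinearMap) = Module.finrank k V :=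
  LinearMap.finrank_range_of_inj (intertwiningMap_injective_of_ne_zero hf)

lemma isIrreducible_range_toRepresentation [σ.IsIrreducible] {f : IntertwiningMap σ ρ}
    (hf : f ≠ 0) : f.range.toRepresentation.IsIrreducible := by
  let f' : IntertwiningMap σ f.range.toRepresentation :=
    f.toLinearMap.rangeRestrict.intertwiningMap_of_isIntertwiningMap _ _
      fun g v => Subtype.ext (f.isIntertwining _ _ g v)
  have hbij : Function.Bijective f' :=
    ⟨fun _ _ h => intertwiningMap_injective_of_ne_zero hf (congrArg Subtype.val h),
      f.toLinearMap.surjective_rangeRestrict⟩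
  rw [irreducible_iff_isSimpleModule_asModule]
  exact IsSimpleModule.congr
    (LinearEquiv.ofBijective (IntertwiningMap.equivLinearMapAsModule _ _ f') hbij).symm

lemma intertwiningMap_eq_zero_of_finrank_lt [σ.IsIrreducible]
    [FiniteDimensional k W] (h : Module.finrank k W < Module.finrank k V)
    (f : IntertwiningMap σ ρ) : f = 0 :=
  (IsIrreducible.injective_or_eq_zero f).resolve_left fun hf =>
    h.not_ge (LinearMap.finrank_le_finrank_of_injective (f := f.toLinearMap) hf)

end Irreducible

section IrreducibleFamily

open Representation
open scoped MonoidAlgebra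

variable {k G W ι : Type*} [Field k] [Monoid G] [AddCommGroup W] [Module k W]
  {ρ : Representation k G W} {V : ι → Type*} [∀ i, AddCommGroup (V i)] [∀ i, Module k (V i)]
  {σ : ∀ i, Representation k G (V i)} [∀ i, (σ i).IsIrreducible]

lemma iSupIndep_range_intertwiningMap
    (hσ : Pairwise fun i j => IsEmpty ((σ i).Equiv (σ j)))
    {f : ∀ i, IntertwiningMap (σ i) ρ} (hf : ∀ i, f i ≠ 0) :
    iSupIndep fun i => LinearMap.range (f i).toLinearMap := by
  let F i := IntertwiningMap.equivLinearMapAsModule _ _ (f i)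
  let e i : (σ i).asModule ≃ₗ[k[G]] LinearMap.range (F i) := .ofInjective (F i)
    (intertwiningMap_injective_of_ne_zero (σ := σ i) (hf i))
  have hsimple i : IsSimpleModule k[G] (LinearMap.range (F i)) := IsSimpleModule.congr (e i).symm
  have hind : iSupIndep fun i => LinearMap.range (F i) :=
    iSupIndep_of_isSimpleModule _ fun i j hij => ⟨fun e' => by
      let E := (IntertwiningMap.equivLinearMapAsModule (σ i) (σ j)).symm
        ((e i).trans (e'.trans (e j).symm)).toLinearMap
      exact (hσ hij).false (E.ofBijective ((e i).trans (e'.trans (e j).symm)).bijective)⟩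
  classical
  rw [iSupIndep_iff_finsetSum_eq_zero_imp_eq_zero] at hind ⊢
  exact hind

lemma isEmpty_equiv_of_finrank_ne {V W : Type*} [AddCommGroup V] [Module k V]
    [AddCommGroup W] [Module k W] {σ : Representation k G V} {ρ : Representation k G W}
    (h : Module.finrank k V ≠ Module.finrank k W) : IsEmpty (σ.Equiv ρ) :=
  ⟨fun e => h e.toLinearEquiv.finrank_eq⟩

end IrreducibleFamily

/-! ### Coherent vectors -/

lemma eq_zero_of_sum_pow_smul_eq_zero {K V : Type*} [Field K] [AddCommGroup V] [Module K V]
    {n : ℕ} {v : Fin n → V} {s : Set K} (hs : s.Infinite)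
    (h : ∀ t ∈ s, ∑ k : Fin n, t ^ (k : ℕ) • v k = 0) (k : Fin n) : v k = 0 := by
  refine (Module.forall_dual_apply_eq_zero_iff K _).1 fun f => ?_
  let p : Polynomial K := ∑ i : Fin n, Polynomial.monomial i (f (v i))
  have hp : p = 0 := Polynomial.eq_zero_of_infinite_isRoot _ <| hs.mono fun t ht => by
    simpa [p, Polynomial.eval_finsetSum, Polynomial.eval_monomial, mul_comm]
      using congrArg f (h t ht)
  simpa [p, Polynomial.finsetSum_coeff, Polynomial.coeff_monomial, Fin.val_inj]
    using congrArg (Polynomial.coeff · k) hp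

/-- The coherent vector of `(z, w)`: the `N`-th symmetric power of the vector `(z, w)` of `ℂ²`,
in the orthonormal basis used by `symMatrix`. -/
def coherent (N : ℕ) (z w : ℂ) : Fin (N + 1) → ℂ :=
  fun a => (√(N.choose a : ℝ) : ℂ) * z ^ (N - (a : ℕ)) * w ^ (a : ℕ)

lemma ofReal_sqrt_choose_ne_zero {N k : ℕ} (hk : k ≤ N) : ((√(N.choose k : ℝ) : ℝ) : ℂ) ≠ 0 := by
  have := Nat.choose_pos hk
  exact Complex.ofReal_ne_zero.2 (by positivity)

lemma ofReal_sqrt_mul_self {x : ℝ} (hx : 0 ≤ x) : ((√x : ℝ) : ℂ) * ((√x : ℝ) : ℂ) = (x : ℂ) := by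
  rw [← Complex.ofReal_mul, Real.mul_self_sqrt hx]

lemma coherent_smul (N : ℕ) (u z w : ℂ) :
    coherent N (u * z) (u * w) = u ^ N • coherent N z w := by
  funext a
  have hu : u ^ N = u ^ (N - (a : ℕ)) * u ^ (a : ℕ) := by
    rw [← pow_add, Nat.sub_add_cancel a.is_le]
  simp only [coherent, Pi.smul_apply, smul_eq_mul, mul_pow, hu]
  ring

lemma coherent_ne_zero (N : ℕ) {z w : ℂ} (hz : z ≠ 0) (hw : w ≠ 0) (a : Fin (N + 1)) :
    coherent N z w a ≠ 0 :=
  mul_ne_zero (mul_ne_zero (ofReal_sqrt_choose_ne_zero a.is_le) (pow_ne_zero _ hz))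
    (pow_ne_zero _ hw)

lemma coherent_dotProduct (N : ℕ) (z w x y : ℂ) :
    coherent N z w ⬝ᵥ coherent N x y = (z * x + w * y) ^ N := by
  rw [add_comm (z * x), add_pow, Finset.sum_range]
  refine Finset.sum_congr rfl fun a _ => ?_
  have h := ofReal_sqrt_mul_self (Nat.cast_nonneg (N.choose a))
  push_cast at h
  simp only [coherent, mul_pow, ← h]
  ring

lemma star_coherent (N : ℕ) (z w : ℂ) :
    star (coherent N z w) = coherent N (conj z) (conj w) := by
  funext a
  simp [coherent]

section Extensionality

variable {V : Type*} [AddCommGroup V] [Module ℂ V] {N : ℕ}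

lemma map_coherent_one (T : (Fin (N + 1) → ℂ) →ₗ[ℂ] V) (t : ℂ) :
    T (coherent N 1 t) =
      ∑ k : Fin (N + 1), t ^ (k : ℕ) • ((√(N.choose k : ℝ) : ℝ) : ℂ) • T (Pi.single k 1) := by
  rw [T.pi_apply_eq_sum_univ]
  refine Finset.sum_congr rfl fun k _ => ?_
  simp only [smul_smul, coherent, one_pow, mul_one, mul_comm (t ^ (k : ℕ))]
  congr 2
  funext i
  simp [Pi.single_apply, eq_comm]

lemma linearMap_ext_coherent {S T : (Fin (N + 1) → ℂ) →ₗ[ℂ] V} {s : Set ℂ} (hs : s.Infinite)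
    (h : ∀ t ∈ s, S (coherent N 1 t) = T (coherent N 1 t)) : S = T := by
  refine LinearMap.pi_ext' fun k => LinearMap.ext_ring (sub_eq_zero.1 ?_)
  refine (smul_eq_zero.1 (eq_zero_of_sum_pow_smul_eq_zero hs
    (v := fun k => ((√(N.choose k : ℝ) : ℝ) : ℂ) • (S - T) (Pi.single k 1))
    (fun t ht => ?_) k)).resolve_left (ofReal_sqrt_choose_ne_zero k.is_le)
  rw [← map_coherent_one, LinearMap.sub_apply, h t ht, sub_self]

lemma eq_of_coherent_dotProduct_eq {x y : Fin (N + 1) → ℂ}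
    (h : ∀ t, coherent N 1 t ⬝ᵥ x = coherent N 1 t ⬝ᵥ y) : x = y :=
  (dotProductEquiv ℂ (Fin (N + 1))).injective <|
    linearMap_ext_coherent Set.infinite_univ fun t _ => by
      simpa only [dotProductEquiv_apply_apply, dotProduct_comm _ (coherent N 1 t)] using h t

lemma matrix_ext_coherent {M : Type*} {A B : Matrix M (Fin (N + 1)) ℂ}
    (h : ∀ t, A.mulVec (coherent N 1 t) = B.mulVec (coherent N 1 t)) : A = B :=
  Matrix.toLin'.injective <|
    linearMap_ext_coherent Set.infinite_univ fun t _ => by simpa using h t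

end Extensionality

/-! ### The spin representation -/

lemma symMatrix_col_zero (N : ℕ) (g : Matrix (Fin 2) (Fin 2) ℂ) :
    (symMatrix N g).col 0 = coherent N (g 0 0) (g 1 0) := by
  funext a
  have hcoeff : (symPoly N g 0).coeff a =
      (N.choose a : ℂ) * g 0 0 ^ (N - (a : ℕ)) * g 1 0 ^ (a : ℕ) := by
    have hcomp : symPoly N g 0 =
        ((Polynomial.X + Polynomial.C (g 0 0)) ^ N).comp (Polynomial.C (g 1 0) * Polynomial.X) := by
      simp [symPoly, add_comm]
    rw [hcomp, Polynomial.comp_C_mul_X_coeff, Polynomial.coeff_X_add_C_pow]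
    ring
  have hsqrt := ofReal_sqrt_mul_self (Nat.cast_nonneg (N.choose a))
  have hne := ofReal_sqrt_choose_ne_zero a.is_le
  push_cast at hsqrt
  simp only [symMatrix, Matrix.col_apply, Matrix.of_apply, Fin.val_zero, hcoeff, coherent,
    Nat.choose_zero_right, ← hsqrt]
  push_cast
  field_simp
  simp

lemma symMatrix_mulVec_coherent (N : ℕ) {g : Matrix (Fin 2) (Fin 2) ℂ}
    (hg : g 0 0 ≠ 0 ∨ g 1 0 ≠ 0) (z w : ℂ) :
    (symMatrix N g).mulVec (coherent N z w) =
      coherent N (g 0 0 * z + g 0 1 * w) (g 1 0 * z + g 1 1 * w) := by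
  have hcol : (symMatrix N !![z, 0; w, 0]).col 0 = coherent N z w := by
    simp [symMatrix_col_zero]
  rw [← hcol, ← Matrix.mulVec_single_one, Matrix.mulVec_mulVec, ← symMatrix_mul N g _ hg,
    Matrix.mulVec_single_one, symMatrix_col_zero]
  simp [Matrix.mul_apply, Fin.sum_univ_two]

lemma su2_col_ne_zero (g : SU2) : g.1 0 0 ≠ 0 ∨ g.1 1 0 ≠ 0 := by
  by_contra! h
  simpa [h.1, h.2] using (su2_entries g).2.2

lemma spinRep_mulVec_coherent (N : ℕ) (g : SU2) (z w : ℂ) :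
    (spinRep N g).mulVec (coherent N z w) =
      coherent N (g.1 0 0 * z + g.1 0 1 * w) (g.1 1 0 * z + g.1 1 1 * w) :=
  symMatrix_mulVec_coherent N (su2_col_ne_zero g) z w

lemma spinRep_inv (N : ℕ) (g : SU2) : spinRep N g⁻¹ = (spinRep N g).conjTranspose := by
  refine matrix_ext_coherent fun t => eq_of_coherent_dotProduct_eq fun s => ?_
  have hs : coherent N 1 s = star (coherent N 1 (conj s)) := by simp [star_coherent]
  have hg : (g⁻¹).1 = star g.1 := rfl
  rw [spinRep_mulVec_coherent, coherent_dotProduct, Matrix.dotProduct_mulVec, hs,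
    ← Matrix.star_mulVec, spinRep_mulVec_coherent, star_coherent, coherent_dotProduct, hg]
  congr 1
  simp only [Matrix.star_apply, RCLike.star_def, map_add, map_mul, map_one, Complex.conj_conj]
  ring

/-- The representation `spinRep` on `ℂ^(N+1)`. -/
def spinRepresentation (N : ℕ) : Representation ℂ SU2 (Fin (N + 1) → ℂ) :=
  (Matrix.toLinAlgEquiv' : Op N ≃ₐ[ℂ] _).toMonoidHom.comp (spinRep N)

lemma spinRepresentation_apply (N : ℕ) (g : SU2) (x : Fin (N + 1) → ℂ) :
    spinRepresentation N g x = (spinRep N g).mulVec x := rfl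

lemma isIntertwiningMap_of_coherent {V : Type*} [AddCommGroup V] [Module ℂ V]
    {ρ : Representation ℂ SU2 V} {N : ℕ} {T : (Fin (N + 1) → ℂ) →ₗ[ℂ] V}
    (h : ∀ g t, g.1 0 0 + g.1 0 1 * t ≠ 0 → ρ g (T (coherent N 1 t)) =
      T (coherent N (g.1 0 0 + g.1 0 1 * t) (g.1 1 0 + g.1 1 1 * t)))
    (g : SU2) (x : Fin (N + 1) → ℂ) : T (spinRepresentation N g x) = ρ g (T x) := by
  let p : Polynomial ℂ := Polynomial.C (g.1 0 1) * Polynomial.X + Polynomial.C (g.1 0 0)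
  have hp : p ≠ 0 := fun hp => by
    have h0 : g.1 0 0 = 0 := by simpa [p] using congrArg (Polynomial.coeff · 0) hp
    have h1 : g.1 0 1 = 0 := by simpa [p] using congrArg (Polynomial.coeff · 1) hp
    rcases su2_col_ne_zero g with h' | h'
    · exact h' h0
    · exact h' (by simpa [(su2_entries g).1] using h1)
  have hcomp : T ∘ₗ spinRepresentation N g = ρ g ∘ₗ T :=
    linearMap_ext_coherent (Polynomial.finite_setOfPred_isRoot hp).infinite_compl fun t ht => by
      have ht' : g.1 0 0 + g.1 0 1 * t ≠ 0 := fun h0 => ht (by simp [p, add_comm, h0])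
      simp only [LinearMap.comp_apply, spinRepresentation_apply, spinRep_mulVec_coherent, mul_one,
        h g t ht']
  exact LinearMap.congr_fun hcomp x

/-! ### Irreducibility of the spin representation -/

lemma single_mem_of_mul_mem {K ι : Type*} [Field K] [Finite ι] [DecidableEq ι] {μ : ι → K}
    (hμ : Function.Injective μ) {U : Submodule K (ι → K)} (hU : ∀ x ∈ U, μ * x ∈ U)
    {x : ι → K} (hx : x ∈ U) {i : ι} (hi : x i ≠ 0) : Pi.single i (1 : K) ∈ U := by
  have := Fintype.ofFinite ι
  have hmem := U.smul_mem (x i)⁻¹ (Polynomial.aeval_apply_smul_mem_of_le_comap' hx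
    (Lagrange.basis Finset.univ μ i) μ hU)
  convert hmem using 1
  funext j
  simp only [Pi.smul_apply, Pi.mul_apply, smul_eq_mul, Polynomial.aeval_pi_apply₂,
    Polynomial.coe_aeval_eq_eval]
  obtain rfl | hij := eq_or_ne j i
  · rw [Lagrange.eval_basis_self hμ.injOn (Finset.mem_univ j), one_mul, inv_mul_cancel₀ hi,
      Pi.single_eq_same]
  · rw [Lagrange.eval_basis_of_ne hij.symm (Finset.mem_univ j), zero_mul, mul_zero,
      Pi.single_eq_of_ne hij]

lemma exp_int_mul_I_injective : Function.Injective fun p : ℤ => Complex.exp (p * Complex.I) := by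
  intro p q h
  obtain ⟨r, hr⟩ := Complex.exp_eq_exp_iff_exists_int.1 h
  have hpq : (p : ℝ) = q + r * (2 * Real.pi) := by
    have : (p : ℂ) * Complex.I = ((q : ℂ) + r * (2 * Real.pi)) * Complex.I := by rw [hr]; ring
    exact_mod_cast mul_right_cancel₀ Complex.I_ne_zero this
  obtain rfl | hr0 := eq_or_ne r 0
  · simpa using hpq
  · refine absurd ⟨((p - q : ℤ) : ℚ), ?_⟩ (irrational_pi.intCast_mul (m := 2 * r) (by simpa))
    push_cast
    linarith

/-- The element of `SU(2)` with first column `(a, c)`. -/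
def su2OfColumn (a c : ℂ) (h : Complex.normSq a + Complex.normSq c = 1) : SU2 :=
  ⟨!![a, -conj c; c, conj a], by
    have h' : a * conj a + c * conj c = 1 := by
      rw [Complex.mul_conj, Complex.mul_conj]
      exact_mod_cast h
    rw [Matrix.mem_specialUnitaryGroup_iff, Matrix.mem_unitaryGroup_iff']
    constructor
    · have hstar : star !![a, -conj c; c, conj a] = !![conj a, conj c; -c, a] := by
        rw [Matrix.star_eq_conjTranspose]
        ext i k
        fin_cases i <;> fin_cases k <;> simp
      rw [hstar, Matrix.mul_fin_two, Matrix.one_fin_two]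
      congr! 4 <;> grind
    · rw [Matrix.det_fin_two_of]
      linear_combination h'⟩

/-- The diagonal element of `SU(2)` with entries `exp i`, `exp (-i)`; the angle is not a rational
multiple of `π`, so that distinct weights have distinct eigenvalues. -/
def torusElt : SU2 := su2OfColumn (Complex.exp Complex.I) 0
  (by simp [Complex.normSq_eq_norm_sq, Complex.norm_exp])

lemma spinRep_torusElt (N : ℕ) :
    spinRep N torusElt = Matrix.diagonal fun a : Fin (N + 1) =>
      Complex.exp ((N - 2 * a : ℤ) * Complex.I) := by
  refine matrix_ext_coherent fun t => funext fun a => ?_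
  rw [spinRep_mulVec_coherent, Matrix.mulVec_diagonal]
  simp only [torusElt, su2OfColumn, coherent, Matrix.of_apply, Matrix.cons_val',
    Matrix.cons_val_zero, Matrix.cons_val_one, Matrix.cons_val_fin_one, map_zero, neg_zero,
    zero_mul, add_zero, zero_add, mul_one, one_pow, mul_pow, ← Complex.exp_conj, Complex.conj_I,
    ← Complex.exp_nat_mul]
  have hexp : Complex.exp ((N - 2 * a : ℤ) * Complex.I) =
      Complex.exp (((N - a : ℕ) : ℂ) * Complex.I) * Complex.exp (((a : ℕ) : ℂ) * -Complex.I) := by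
    rw [← Complex.exp_add]
    congr 1
    push_cast [a.is_le]
    ring
  rw [hexp]
  ring

lemma exp_weight_injective (N : ℕ) : Function.Injective
    fun a : Fin (N + 1) => Complex.exp ((N - 2 * a : ℤ) * Complex.I) :=
  exp_int_mul_I_injective.comp fun a b hab => Fin.ext (by simpa using hab)

/-- An element of `SU(2)` all of whose entries are nonzero. -/
def rationalElt : SU2 := su2OfColumn (3 / 5) (4 / 5) (by norm_num [Complex.normSq_apply])

lemma spinRep_rationalElt_apply_zero_ne_zero (N : ℕ) (a : Fin (N + 1)) :
    spinRep N rationalElt a 0 ≠ 0 := by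
  have hcol := congrFun (symMatrix_col_zero N rationalElt.1) a
  exact hcol.trans_ne (coherent_ne_zero N (by simp [rationalElt, su2OfColumn])
    (by simp [rationalElt, su2OfColumn]) a)

lemma spinRep_rationalElt_inv_zero_apply_ne_zero (N : ℕ) (a : Fin (N + 1)) :
    spinRep N rationalElt⁻¹ 0 a ≠ 0 := by
  simpa [spinRep_inv] using spinRep_rationalElt_apply_zero_ne_zero N a

instance spinRepresentation_isIrreducible (N : ℕ) : (spinRepresentation N).IsIrreducible where
  exists_pair_ne := ⟨⊥, ⊤, fun h => bot_ne_top (α := Submodule ℂ (Fin (N + 1) → ℂ))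
    (congrArg Subrepresentation.toSubmodule h)⟩
  eq_bot_or_eq_top U := by
    have single_mem {x : Fin (N + 1) → ℂ} (hx : x ∈ U.toSubmodule) {k : Fin (N + 1)}
        (hk : x k ≠ 0) : Pi.single k (1 : ℂ) ∈ U.toSubmodule := by
      refine single_mem_of_mul_mem (exp_weight_injective N) (fun y hy => ?_) hx hk
      convert U.apply_mem_toSubmodule torusElt hy using 1
      rw [spinRepresentation_apply, spinRep_torusElt]
      funext a
      rw [Matrix.mulVec_diagonal, Pi.mul_apply]
    refine or_iff_not_imp_left.2 fun hU => Subrepresentation.toSubmodule_injective ?_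
    obtain ⟨x, hx, hx0⟩ := U.toSubmodule.exists_mem_ne_zero_of_ne_bot fun h =>
      hU (Subrepresentation.toSubmodule_injective h)
    obtain ⟨b, hb⟩ := Function.ne_iff.1 hx0
    have hzero : Pi.single (0 : Fin (N + 1)) (1 : ℂ) ∈ U.toSubmodule := by
      refine single_mem (U.apply_mem_toSubmodule rationalElt⁻¹ (single_mem hx hb)) ?_
      rw [spinRepresentation_apply, Matrix.mulVec_single_one]
      exact spinRep_rationalElt_inv_zero_apply_ne_zero N b
    have hsingle (a : Fin (N + 1)) : Pi.single a (1 : ℂ) ∈ U.toSubmodule := by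
      refine single_mem (U.apply_mem_toSubmodule rationalElt hzero) ?_
      rw [spinRepresentation_apply, Matrix.mulVec_single_one]
      exact spinRep_rationalElt_apply_zero_ne_zero N a
    refine eq_top_iff.2 fun y _ => ?_
    rw [pi_eq_sum_univ' y]
    exact U.toSubmodule.sum_mem fun a _ => by
      simpa [Pi.single_apply] using U.toSubmodule.smul_mem (y a) (hsingle a)

/-! ### Ladder coefficients -/

/-- The matrix entry `√((n - b)(b + 1))` of `J₋` in column `b`. -/
def lowerCoeff (n b : ℕ) : ℝ := √(((n : ℝ) - b) * (b + 1))

lemma beta_sub (l k : ℕ) : beta l ((l : ℤ) - k) = lowerCoeff (2 * l) k := by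
  unfold beta lowerCoeff
  congr 1
  push_cast
  ring

section LowerCoeff

variable {n b : ℕ}

lemma lowerCoeff_ne_zero (hb : b < n) : lowerCoeff n b ≠ 0 := by
  have : (0 : ℝ) < (n : ℝ) - b := sub_pos.2 (by exact_mod_cast hb)
  exact (Real.sqrt_pos.2 (by positivity)).ne'

lemma lowerCoeff_mul_self (hb : b ≤ n) :
    (lowerCoeff n b : ℂ) * lowerCoeff n b = ((n : ℂ) - b) * (b + 1) := by
  have : (0 : ℝ) ≤ (n : ℝ) - b := sub_nonneg.2 (by exact_mod_cast hb)
  rw [lowerCoeff, ofReal_sqrt_mul_self (by positivity)]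
  push_cast
  ring

lemma choose_succ_mul_succ (hb : b ≤ n) :
    (n.choose (b + 1) : ℝ) * (b + 1) = n.choose b * (n - b) := by
  have := congrArg (Nat.cast (R := ℝ)) (Nat.choose_succ_right_eq n b)
  push_cast [Nat.cast_sub hb] at this
  exact this

lemma lowerCoeff_mul_sqrt_choose_succ (hb : b ≤ n) :
    lowerCoeff n b * √(n.choose (b + 1) : ℝ) = (n - b) * √(n.choose b : ℝ) := by
  have hnb : (0 : ℝ) ≤ (n : ℝ) - b := sub_nonneg.2 (by exact_mod_cast hb)
  have h : ((n : ℝ) - b) * (b + 1) * n.choose (b + 1) = (n - b) ^ 2 * n.choose b := by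
    linear_combination (n - b : ℝ) * choose_succ_mul_succ hb
  rw [lowerCoeff, ← Real.sqrt_mul (by positivity), h, Real.sqrt_mul (by positivity),
    Real.sqrt_sq hnb]

lemma lowerCoeff_mul_sqrt_choose (hb : b ≤ n) :
    lowerCoeff n b * √(n.choose b : ℝ) = (b + 1) * √(n.choose (b + 1) : ℝ) := by
  have hnb : (0 : ℝ) ≤ (n : ℝ) - b := sub_nonneg.2 (by exact_mod_cast hb)
  have h : ((n : ℝ) - b) * (b + 1) * n.choose b = (b + 1) ^ 2 * n.choose (b + 1) := by
    linear_combination -(b + 1 : ℝ) * choose_succ_mul_succ hb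
  rw [lowerCoeff, ← Real.sqrt_mul (by positivity), h, Real.sqrt_mul (by positivity),
    Real.sqrt_sq (by positivity)]

end LowerCoeff

/-! ### Generating functions of lowering sequences -/

section CoeffDerivation

variable {R : Type*} [Ring R]

/-- The property that the map `D`, applied to coefficients, agrees with `d/dX` on `p`. If `D` is
a derivation, it is inherited by products. -/
def CoeffDerivation (D : R →+ R) (p : Polynomial R) : Prop :=
  ∀ k, D (p.coeff k) = (Polynomial.derivative p).coeff k

variable {D : R →+ R}

lemma CoeffDerivation.mul (hD : ∀ a b, D (a * b) = D a * b + a * D b)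
    {p q : Polynomial R} (hp : CoeffDerivation D p) (hq : CoeffDerivation D q) :
    CoeffDerivation D (p * q) := by
  intro k
  simp only [Polynomial.derivative_mul, Polynomial.coeff_add, Polynomial.coeff_mul, map_sum, hD,
    hp _, hq _, Finset.sum_add_distrib]

lemma CoeffDerivation.pow (hD : ∀ a b, D (a * b) = D a * b + a * D b)
    {p : Polynomial R} (hp : CoeffDerivation D p) (l : ℕ) : CoeffDerivation D (p ^ l) := by
  induction l with
  | zero =>
    intro k
    have hone : D 1 = 0 := by simpa using hD 1 1
    rw [pow_zero, Polynomial.derivative_one, Polynomial.coeff_zero, Polynomial.coeff_one]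
    split_ifs
    exacts [hone, map_zero D]
  | succ l ih => exact pow_succ p l ▸ ih.mul hD hp

/-- The polynomial `A - 2 Z X - B X ^ 2`. -/
def lowerPoly (A Z B : R) : Polynomial R :=
  Polynomial.C A - Polynomial.C (2 * Z) * Polynomial.X - Polynomial.C B * Polynomial.X ^ 2

variable {A Z B : R}

lemma coeffDerivation_lowerPoly (hA : D A = -(2 * Z)) (hZ : D Z = B) (hB : D B = 0) :
    CoeffDerivation D (lowerPoly A Z B) := by
  have hZ2 : D (2 * Z) = 2 * B := by rw [two_mul, map_add, hZ, ← two_mul]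
  intro k
  simp only [lowerPoly, Polynomial.coeff_derivative, Polynomial.coeff_sub, Polynomial.coeff_C_mul,
    Polynomial.coeff_X_pow, Polynomial.coeff_X, Polynomial.coeff_C]
  rcases k with _ | _ | _ | k <;>
    simp [hA, hZ2, hB, one_add_one_eq_two, two_mul B, mul_two B]

lemma natDegree_lowerPoly_pow_le (l : ℕ) : (lowerPoly A Z B ^ l).natDegree ≤ 2 * l := by
  rw [mul_comm]
  refine Polynomial.natDegree_pow_le_of_le l ?_
  unfold lowerPoly
  compute_degree!

lemma coeff_zero_lowerPoly_pow (l : ℕ) : (lowerPoly A Z B ^ l).coeff 0 = A ^ l := by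
  rw [← Polynomial.constantCoeff_apply, map_pow]
  simp [lowerPoly]

lemma sum_smul_coeff_lowerPoly_pow {K : Type*} [CommRing K] [Algebra K R] (l : ℕ) (t : K) :
    ∑ k : Fin (2 * l + 1), t ^ (k : ℕ) • (lowerPoly A Z B ^ l).coeff k =
      (A - (2 * t) • Z - t ^ 2 • B) ^ l := by
  let ev : Polynomial R →+* R := Polynomial.eval₂RingHom' (RingHom.id R) (algebraMap K R t)
    fun a => (Algebra.commutes t a).symm
  have hX : ev Polynomial.X = algebraMap K R t := Polynomial.eval₂_X _ _
  have hC a : ev (Polynomial.C a) = a := Polynomial.eval₂_C _ _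
  have hev : ev (lowerPoly A Z B) = A - (2 * t) • Z - t ^ 2 • B := by
    simp only [lowerPoly, map_sub, map_mul, map_pow, hX, hC]
    rw [← map_pow, ← Algebra.commutes, ← Algebra.commutes, ← Algebra.smul_def, ← Algebra.smul_def,
      two_mul, two_mul, smul_add, add_smul]
  rw [← hev, ← map_pow]
  refine Eq.trans ?_ (Polynomial.eval₂_eq_sum_range' (RingHom.id R)
    (Nat.lt_succ_of_le (natDegree_lowerPoly_pow_le l)) (algebraMap K R t)).symm
  rw [Finset.sum_range]
  refine Finset.sum_congr rfl fun k _ => ?_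
  rw [← map_pow, ← Algebra.commutes, ← Algebra.smul_def, RingHom.id_apply]

end CoeffDerivation

section LoweringSequence

variable {R : Type*} [Ring R] [Algebra ℂ R] {D : R →ₗ[ℂ] R} {A Z B : R} {l : ℕ} {c : ℂ}
  {v : ℕ → R}

lemma sqrt_choose_smul_lowering (hD : ∀ a b, D (a * b) = D a * b + a * D b)
    (hA : D A = -(2 * Z)) (hZ : D Z = B) (hB : D B = 0) (h0 : v 0 = c • A ^ l)
    (hv : ∀ k, v (k + 1) = ((1 / beta l ((l : ℤ) - k) : ℝ) : ℂ) • D (v k)) {k : ℕ}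
    (hk : k ≤ 2 * l) :
    ((√((2 * l).choose k : ℝ) : ℝ) : ℂ) • v k = c • (lowerPoly A Z B ^ l).coeff k := by
  induction k with
  | zero => simp [h0, coeff_zero_lowerPoly_pow]
  | succ k ih =>
    have hcoeff := (coeffDerivation_lowerPoly (D := D.toAddMonoidHom) hA hZ hB).pow hD l k
    have hDcoeff : D ((lowerPoly A Z B ^ l).coeff k) =
        ((k : ℂ) + 1) • (lowerPoly A Z B ^ l).coeff (k + 1) := by
      refine hcoeff.trans ?_
      rw [Polynomial.coeff_derivative, Algebra.smul_def, Algebra.commutes]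
      simp
    have hDv : D (v k) = (lowerCoeff (2 * l) k : ℂ) • v (k + 1) := by
      rw [hv, beta_sub, smul_smul, ← Complex.ofReal_mul,
        mul_one_div_cancel (lowerCoeff_ne_zero hk), Complex.ofReal_one, one_smul]
    have hsqrt := congrArg Complex.ofReal (lowerCoeff_mul_sqrt_choose (Nat.le_of_succ_le hk))
    simp only [Complex.ofReal_mul, Complex.ofReal_add, Complex.ofReal_natCast,
      Complex.ofReal_one] at hsqrt
    refine smul_right_injective R (Nat.cast_add_one_ne_zero (R := ℂ) k) ?_
    calc ((k : ℂ) + 1) • ((√((2 * l).choose (k + 1) : ℝ) : ℝ) : ℂ) • v (k + 1)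
        = D (((√((2 * l).choose k : ℝ) : ℝ) : ℂ) • v k) := by
          rw [map_smul, hDv, smul_smul, smul_smul]
          congr 1
          linear_combination -hsqrt
      _ = ((k : ℂ) + 1) • c • (lowerPoly A Z B ^ l).coeff (k + 1) := by
          rw [ih (Nat.le_of_succ_le hk), map_smul, hDcoeff, smul_comm]

lemma linearCombination_lowering_coherent (hD : ∀ a b, D (a * b) = D a * b + a * D b)
    (hA : D A = -(2 * Z)) (hZ : D Z = B) (hB : D B = 0) (h0 : v 0 = c • A ^ l)
    (hv : ∀ k, v (k + 1) = ((1 / beta l ((l : ℤ) - k) : ℝ) : ℂ) • D (v k))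
    {z : ℂ} (hz : z ≠ 0) (w : ℂ) :
    Fintype.linearCombination ℂ (fun k : Fin (2 * l + 1) => v k) (coherent (2 * l) z w) =
      c • (z ^ 2 • A - (2 * (z * w)) • Z - w ^ 2 • B) ^ l := by
  have hone (t : ℂ) : Fintype.linearCombination ℂ (fun k : Fin (2 * l + 1) => v k)
      (coherent (2 * l) 1 t) = c • (A - (2 * t) • Z - t ^ 2 • B) ^ l := by
    rw [← sum_smul_coeff_lowerPoly_pow, Finset.smul_sum, map_coherent_one]
    refine Finset.sum_congr rfl fun k _ => ?_
    rw [Fintype.linearCombination_apply_single, one_smul,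
      sqrt_choose_smul_lowering hD hA hZ hB h0 hv k.is_le, smul_comm]
  have hw : coherent (2 * l) z w = z ^ (2 * l) • coherent (2 * l) 1 (w / z) := by
    rw [← coherent_smul, mul_one, mul_div_cancel₀ w hz]
  rw [hw, map_smul, hone, smul_comm, pow_mul, ← smul_pow, smul_sub, smul_sub, smul_smul, smul_smul]
  congr 4
  all_goals field_simp

end LoweringSequence

/-! ### The operators `J₊`, `J₃`, `J₋` -/

section Operators

variable {n : ℕ}

lemma Jminus_zero_row : Jminus n 0 = 0 := by
  funext b
  simp [Jminus]

lemma Jminus_succ_row (a : Fin n) :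
    Jminus n a.succ = Pi.single a.castSucc (lowerCoeff n a : ℂ) := by
  funext b
  rw [Pi.single_apply, Jminus, Matrix.of_apply, Fin.val_succ]
  by_cases h : b = a.castSucc
  · simp [h, lowerCoeff]
  · rw [if_neg h, if_neg fun e => h (Fin.ext (by simpa using e.symm))]

lemma Jplus_last_row : Jplus n (Fin.last n) = 0 := by
  funext b
  simp [Jplus, Jminus, b.is_lt.ne]

lemma Jplus_castSucc_row (a : Fin n) :
    Jplus n a.castSucc = Pi.single a.succ (lowerCoeff n a : ℂ) := by
  funext b
  rw [Pi.single_apply, Jplus, Matrix.transpose_apply, Jminus, Matrix.of_apply]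
  by_cases h : b = a.succ
  · simp [h, lowerCoeff]
  · rw [if_neg h, if_neg fun e => h (Fin.ext (by simpa using e))]

lemma Jminus_mul_Jplus :
    Jminus n * Jplus n =
      Matrix.diagonal fun a : Fin (n + 1) => ((n : ℂ) - (a : ℕ) + 1) * (a : ℕ) := by
  ext a b
  rw [Matrix.mul_apply', Matrix.diagonal_apply]
  refine Fin.cases ?_ (fun a => ?_) a
  · simp [Jminus_zero_row]
  · rw [Jminus_succ_row, single_dotProduct, Jplus_castSucc_row, Pi.single_apply, mul_ite, mul_zero,
      lowerCoeff_mul_self a.is_lt.le]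
    refine if_congr eq_comm ?_ rfl
    rw [Fin.val_succ]
    push_cast
    ring

lemma Jplus_mul_Jminus :
    Jplus n * Jminus n =
      Matrix.diagonal fun a : Fin (n + 1) => ((n : ℂ) - (a : ℕ)) * ((a : ℕ) + 1) := by
  ext a b
  rw [Matrix.mul_apply', Matrix.diagonal_apply]
  refine Fin.lastCases ?_ (fun a => ?_) a
  · simp [Jplus_last_row]
  · rw [Jplus_castSucc_row, single_dotProduct, Jminus_succ_row, Pi.single_apply, mul_ite, mul_zero,
      lowerCoeff_mul_self a.is_lt.le]
    exact if_congr eq_comm rfl rfl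

/-- The operator `J₃`, with eigenvalues `n/2, n/2 - 1, …, -n/2` on the standard basis. -/
def Jzed (n : ℕ) : Op n := Matrix.diagonal fun a => (n : ℂ) / 2 - (a : ℕ)

lemma Jminus_mul_Jplus_sub : Jminus n * Jplus n - Jplus n * Jminus n = -(2 * Jzed n) := by
  rw [Jminus_mul_Jplus, Jplus_mul_Jminus, Jzed, Matrix.diagonal_sub, two_mul, Matrix.diagonal_add,
    Matrix.diagonal_neg]
  congr 1
  funext a
  ring

lemma Jminus_mul_Jzed_sub : Jminus n * Jzed n - Jzed n * Jminus n = Jminus n := by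
  ext a b
  rw [Jzed, Matrix.sub_apply, Matrix.mul_diagonal, Matrix.diagonal_mul]
  refine Fin.cases ?_ (fun a => ?_) a
  · simp [Jminus_zero_row]
  · rw [Jminus_succ_row, Pi.single_apply]
    split_ifs with h
    · rw [h, Fin.val_succ, Fin.val_castSucc]
      push_cast
      ring
    · simp

/-- The operator `p² J₊ - 2 p q J₃ - q² J₋`; the group acts on these operators through its
standard action on the spinor `(p, q)`. -/
def spinorOp (n : ℕ) (p q : ℂ) : Op n :=
  p ^ 2 • Jplus n - (2 * (p * q)) • Jzed n - q ^ 2 • Jminus n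

/-- The derivative of the coherent vector at `(z, w)` in the direction `(p, q)`. -/
def coherentDeriv (n : ℕ) (z w p q : ℂ) : Fin (n + 1) → ℂ := fun a =>
  (√(n.choose a : ℝ) : ℂ) * ((((n - (a : ℕ) : ℕ) : ℂ) * z ^ (n - (a : ℕ) - 1) * p) * w ^ (a : ℕ) +
    z ^ (n - (a : ℕ)) * (((a : ℕ) : ℂ) * w ^ ((a : ℕ) - 1) * q))

variable {z w p q : ℂ}

lemma hasDerivAt_coherent :
    HasDerivAt (fun e : ℂ => coherent n (z + e * p) (w + e * q)) (coherentDeriv n z w p q) 0 := by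
  refine hasDerivAt_pi.2 fun a => ?_
  have hlin (x y : ℂ) : HasDerivAt (fun e : ℂ => x + e * y) y 0 := by
    simpa using ((hasDerivAt_id (0 : ℂ)).mul_const y).const_add x
  have h := (((hlin z p).fun_pow (n - (a : ℕ))).fun_mul ((hlin w q).fun_pow (a : ℕ))).const_mul
    ((√(n.choose a : ℝ) : ℝ) : ℂ)
  simp only [zero_mul, add_zero, ← mul_assoc] at h
  simpa only [coherent, coherentDeriv, ← mul_assoc] using h

lemma spinRep_mulVec_coherentDeriv (g : SU2) :
    (spinRep n g).mulVec (coherentDeriv n z w p q) =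
      coherentDeriv n (g.1 0 0 * z + g.1 0 1 * w) (g.1 1 0 * z + g.1 1 1 * w)
        (g.1 0 0 * p + g.1 0 1 * q) (g.1 1 0 * p + g.1 1 1 * q) := by
  have h := (spinRep n g).mulVecLin.toContinuousLinearMap.hasFDerivAt.comp_hasDerivAt (0 : ℂ)
    (hasDerivAt_coherent (n := n) (z := z) (w := w) (p := p) (q := q))
  refine h.unique (hasDerivAt_coherent.congr_of_eventuallyEq (.of_forall fun e => ?_))
  refine (spinRep_mulVec_coherent _ _ _ _).trans ?_
  congr 1 <;> ring

lemma Jplus_mulVec_coherent (a : Fin (n + 1)) :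
    (Jplus n).mulVec (coherent n z w) a = (√(n.choose a : ℝ) : ℂ) *
      (((n - (a : ℕ) : ℕ) : ℂ) * z ^ (n - (a : ℕ) - 1) * w ^ ((a : ℕ) + 1)) := by
  rw [Matrix.mulVec]
  refine Fin.lastCases ?_ (fun a => ?_) a
  · simp [Jplus_last_row]
  · have h := congrArg Complex.ofReal (lowerCoeff_mul_sqrt_choose_succ a.is_lt.le)
    simp only [Complex.ofReal_mul, Complex.ofReal_sub, Complex.ofReal_natCast] at h
    rw [Jplus_castSucc_row, single_dotProduct, coherent, Fin.val_succ, Fin.val_castSucc,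
      Nat.sub_add_eq, Nat.cast_sub a.is_lt.le]
    linear_combination (z ^ (n - (a : ℕ) - 1) * w ^ ((a : ℕ) + 1)) * h

lemma Jminus_mulVec_coherent (a : Fin (n + 1)) :
    (Jminus n).mulVec (coherent n z w) a = (√(n.choose a : ℝ) : ℂ) *
      (((a : ℕ) : ℂ) * z ^ (n - (a : ℕ) + 1) * w ^ ((a : ℕ) - 1)) := by
  rw [Matrix.mulVec]
  refine Fin.cases ?_ (fun a => ?_) a
  · simp [Jminus_zero_row]
  · have h := congrArg Complex.ofReal (lowerCoeff_mul_sqrt_choose a.is_lt.le)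
    simp only [Complex.ofReal_mul, Complex.ofReal_add, Complex.ofReal_natCast,
      Complex.ofReal_one] at h
    rw [Jminus_succ_row, single_dotProduct, coherent, Fin.val_succ, Fin.val_castSucc,
      Nat.add_sub_cancel, Nat.sub_add_eq, Nat.sub_add_cancel (Nat.sub_pos_of_lt a.is_lt)]
    push_cast
    linear_combination (z ^ (n - (a : ℕ)) * w ^ (a : ℕ)) * h

lemma spinorOp_mulVec_coherent :
    (spinorOp n p q).mulVec (coherent n z w) = (p * w - q * z) • coherentDeriv n z w p q := by
  funext a
  simp only [spinorOp, Matrix.sub_mulVec, Matrix.smul_mulVec, Pi.sub_apply, Pi.smul_apply,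
    Jplus_mulVec_coherent, Jminus_mulVec_coherent, Jzed, Matrix.mulVec_diagonal, smul_eq_mul,
    coherentDeriv, coherent]
  have hn : (n : ℂ) = ((n - (a : ℕ) : ℕ) : ℂ) + (a : ℕ) := by rw [Nat.cast_sub a.is_le]; ring
  rw [hn]
  generalize n - (a : ℕ) = m
  generalize ((√(n.choose a : ℝ) : ℝ) : ℂ) = s
  generalize (a : ℕ) = b
  rcases m with _ | m <;> rcases b with _ | b <;>
    simp only [Nat.cast_zero, Nat.cast_add, Nat.cast_one, Nat.add_sub_cancel] <;> ring

lemma su2_det (g : SU2) : g.1 0 0 * g.1 1 1 - g.1 0 1 * g.1 1 0 = 1 := by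
  rw [← Matrix.det_fin_two]
  exact (Matrix.mem_specialUnitaryGroup_iff.1 g.2).2

lemma spinRep_mul_spinorOp (g : SU2) :
    spinRep n g * spinorOp n p q =
      spinorOp n (g.1 0 0 * p + g.1 0 1 * q) (g.1 1 0 * p + g.1 1 1 * q) * spinRep n g := by
  refine matrix_ext_coherent fun t => ?_
  rw [← Matrix.mulVec_mulVec, ← Matrix.mulVec_mulVec, spinRep_mulVec_coherent,
    spinorOp_mulVec_coherent, spinorOp_mulVec_coherent, Matrix.mulVec_smul,
    spinRep_mulVec_coherentDeriv]
  congr 1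
  linear_combination -(p * t - q) * su2_det g

lemma opRep_apply (g : SU2) (P : Op n) : opRep n g P = spinRep n g * P * spinRep n g⁻¹ := by
  change spinRep n g * (P * spinRep n g⁻¹) = _
  rw [mul_assoc]

lemma opRep_pow (g : SU2) (P : Op n) (l : ℕ) : opRep n g (P ^ l) = opRep n g P ^ l := by
  simp only [opRep_apply]
  exact (Units.conj_pow (Units.map (spinRep n) (toUnits g)) P l).symm

lemma opRep_spinorOp (g : SU2) :
    opRep n g (spinorOp n p q) =
      spinorOp n (g.1 0 0 * p + g.1 0 1 * q) (g.1 1 0 * p + g.1 1 1 * q) := by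
  rw [opRep_apply, spinRep_mul_spinorOp, mul_assoc, ← map_mul, mul_inv_cancel, map_one, mul_one]

end Operators

/-! ### The coupled basis as a spin representation -/

section Coupled

variable {n l : ℕ}

lemma linearCombination_coupledAux_coherent {z : ℂ} (hz : z ≠ 0) (w : ℂ) :
    Fintype.linearCombination ℂ (fun k : Fin (2 * l + 1) => coupledAux n l k)
        (coherent (2 * l) z w) =
      (((-1) ^ l / opNorm n l : ℝ) : ℂ) • spinorOp n z w ^ l := by
  let D : Op n →ₗ[ℂ] Op n := LinearMap.mulLeft ℂ (Jminus n) - LinearMap.mulRight ℂ (Jminus n)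
  have hD (P Q : Op n) : D (P * Q) = D P * Q + P * D Q := by
    change Jminus n * (P * Q) - P * Q * Jminus n =
      (Jminus n * P - P * Jminus n) * Q + P * (Jminus n * Q - Q * Jminus n)
    noncomm_ring
  exact linearCombination_lowering_coherent hD Jminus_mul_Jplus_sub Jminus_mul_Jzed_sub
    (sub_self (Jminus n * Jminus n)) rfl (fun _ => rfl) hz w

/-- The equivariant map from the spin-`l` representation to the operators which carries the
standard basis to `e(l, l), e(l, l - 1), …, e(l, -l)`. -/
def opEmb (n l : ℕ) : (spinRepresentation (2 * l)).IntertwiningMap (opRep n) :=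
  LinearMap.intertwiningMap_of_isIntertwiningMap _ _ _ <| isIntertwiningMap_of_coherent
    (T := Fintype.linearCombination ℂ fun k : Fin (2 * l + 1) => coupledAux n l k)
    fun g t hu => by
      rw [linearCombination_coupledAux_coherent one_ne_zero,
        linearCombination_coupledAux_coherent hu, map_smul, opRep_pow, opRep_spinorOp, mul_one,
        mul_one]

lemma opEmb_single (k : Fin (2 * l + 1)) : opEmb n l (Pi.single k 1) = coupledAux n l k :=
  (Fintype.linearCombination_apply_single ℂ _ k 1).trans (one_smul ℂ _)

lemma exists_Jplus_pow_zero_row (hl : l ≤ n) :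
    ∃ c : ℂ, c ≠ 0 ∧ (Jplus n ^ l) 0 = Pi.single ⟨l, Nat.lt_succ_of_le hl⟩ c := by
  induction l with
  | zero => exact ⟨1, one_ne_zero, funext fun b => by simp [Matrix.one_eq_pi_single]⟩
  | succ l ih =>
    obtain ⟨c, hc, hrow⟩ := ih (Nat.le_of_succ_le hl)
    refine ⟨c * lowerCoeff n l, mul_ne_zero hc (Complex.ofReal_ne_zero.2 (lowerCoeff_ne_zero hl)),
      ?_⟩
    rw [pow_succ, Matrix.mul_apply_eq_vecMul, hrow, Matrix.single_vecMul]
    exact (congrArg (c • ·) (Jplus_castSucc_row ⟨l, hl⟩)).trans (Pi.single_smul _ _ _).symm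

lemma Jplus_pow_ne_zero (hl : l ≤ n) : Jplus n ^ l ≠ 0 := by
  obtain ⟨c, hc, hrow⟩ := exists_Jplus_pow_zero_row hl
  intro h
  exact hc (Pi.single_eq_zero_iff.1 (hrow.symm.trans (congrFun h 0)))

lemma Jplus_conjTranspose : (Jplus n).conjTranspose = Jminus n := by
  ext a b
  rw [Matrix.conjTranspose_apply, Jplus, Matrix.transpose_apply, Jminus, Matrix.of_apply]
  split_ifs <;> simp

open scoped ComplexOrder in
lemma opNorm_ne_zero (hl : l ≤ n) : opNorm n l ≠ 0 := by
  have hpos : 0 < (Jminus n ^ l * Jplus n ^ l).trace := by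
    rw [← Jplus_conjTranspose, ← Matrix.conjTranspose_pow]
    refine (Matrix.posSemidef_conjTranspose_mul_self _).trace_nonneg.lt_of_ne' ?_
    rw [Ne, Matrix.trace_conjTranspose_mul_self_eq_zero_iff]
    exact Jplus_pow_ne_zero hl
  exact (Real.sqrt_pos.2 (Complex.pos_iff.1 hpos).1).ne'

lemma opEmb_ne_zero (hl : l ≤ n) : opEmb n l ≠ 0 := by
  intro h
  have h0 : coupledAux n l 0 = 0 := by
    rw [← Fin.val_zero (2 * l + 1), ← opEmb_single, h]
    rfl
  refine smul_ne_zero ?_ (Jplus_pow_ne_zero hl) h0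
  exact Complex.ofReal_ne_zero.2 (div_ne_zero (by simp) (opNorm_ne_zero hl))

end Coupled

/-! ### Spherical harmonics as a spin representation -/

section Harmonics

open MvPolynomial in
lemma linearCombination_harmAux_coherent {l : ℕ} {z : ℂ} (hz : z ≠ 0) (w : ℂ) :
    Fintype.linearCombination ℂ (fun k : Fin (2 * l + 1) => harmAux l k) (coherent (2 * l) z w) =
      (((-1) ^ l / harmNorm l : ℝ) : ℂ) • (z ^ 2 • (X 0 + C Complex.I * X 1) -
        (2 * (z * w)) • X 2 - w ^ 2 • (X 0 - C Complex.I * X 1)) ^ l := by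
  let D : Derivation ℂ (MvPolynomial (Fin 3) ℂ) (MvPolynomial (Fin 3) ℂ) :=
    (X 0 - C Complex.I * X 1 : MvPolynomial (Fin 3) ℂ) • pderiv 2 -
      (X 2 : MvPolynomial (Fin 3) ℂ) •
        (pderiv 0 - (C Complex.I : MvPolynomial (Fin 3) ℂ) • pderiv 1)
  have hI : (C Complex.I : MvPolynomial (Fin 3) ℂ) * C Complex.I = -1 := by
    rw [← C_mul, Complex.I_mul_I, C_neg, C_1]
  have hD (p q) : D (p * q) = D p * q + p * D q := by
    rw [D.leibniz, smul_eq_mul, smul_eq_mul]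
    ring
  have hraise : D (X 0 + C Complex.I * X 1) = -(2 * X 2) := by
    simp only [Fin.isValue, Derivation.coe_sub, Derivation.coe_smul, Pi.sub_apply, Pi.smul_apply,
      map_add, pderiv_X, ne_eq, Fin.reduceEq, not_false_eq_true, Pi.single_eq_of_ne,
      Derivation.leibniz, smul_eq_mul, mul_zero, derivation_C, add_zero, Pi.single_eq_same,
      one_ne_zero, zero_ne_one, mul_one, zero_sub, D]
    linear_combination X 2 * hI
  have hzed : D (X 2) = X 0 - C Complex.I * X 1 := by
    simp [D, pderiv_X]
  have hlower : D (X 0 - C Complex.I * X 1) = 0 := by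
    simp only [Fin.isValue, Derivation.coe_sub, Derivation.coe_smul, Pi.sub_apply, Pi.smul_apply,
      map_sub, pderiv_X, ne_eq, Fin.reduceEq, not_false_eq_true, Pi.single_eq_of_ne,
      Derivation.leibniz, smul_eq_mul, mul_zero, derivation_C, add_zero, Pi.single_eq_same,
      one_ne_zero, zero_ne_one, mul_one, zero_add, zero_sub, sub_zero, mul_neg,
      sub_neg_eq_add, D]
    linear_combination -X 2 * hI
  exact linearCombination_lowering_coherent (D := D) hD hraise hzed hlower
    (smul_eq_C_mul _ _).symm (fun _ => (smul_eq_C_mul _ _).symm) hz w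

/-- The restriction of polynomials in `x, y, z` to the sphere. -/
def restrictSphere : MvPolynomial (Fin 3) ℂ →ₐ[ℂ] (S2 → ℂ) :=
  MvPolynomial.aeval fun i x => ((x.1 i : ℝ) : ℂ)

lemma restrictSphere_apply (p : MvPolynomial (Fin 3) ℂ) (x : S2) :
    restrictSphere p x = MvPolynomial.eval (fun i => ((x.1 i : ℝ) : ℂ)) p := by
  have h : (Pi.evalAlgHom ℂ (fun _ : S2 => ℂ) x).comp restrictSphere =
      MvPolynomial.aeval fun i => ((x.1 i : ℝ) : ℂ) := by
    ext i
    simp [restrictSphere]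
  exact DFunLike.congr_fun h p

/-- The quadratic form `p² (x + i y) - 2 p q z - q² (x - i y)` in the spinor `(p, q)`; the group
acts on these functions through its standard action on the spinor. -/
def spinorForm (p q : ℂ) (x : S2) : ℂ :=
  p ^ 2 * (x.1 0 + Complex.I * x.1 1) - 2 * (p * q) * x.1 2 - q ^ 2 * (x.1 0 - Complex.I * x.1 1)

/-- The matrix `x · σ`. -/
def pauliVec (x : S2) : Matrix (Fin 2) (Fin 2) ℂ := ∑ i, ((x.1 i : ℝ) : ℂ) • pauli i

lemma pauliVec_eq (x : S2) :
    pauliVec x = !![(x.1 2 : ℂ), x.1 0 - Complex.I * x.1 1; x.1 0 + Complex.I * x.1 1, -x.1 2] := by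
  ext i k
  fin_cases i <;> fin_cases k <;> simp [pauliVec, pauli, Fin.sum_univ_three] <;> ring

lemma pauliVec_rotate (g : SU2) (x : S2) :
    pauliVec (rotate (cover g) x) = g.1 * pauliVec x * star g.1 := by
  obtain ⟨h01, h11, -⟩ := su2_entries g
  have hrot (i : Fin 3) : (rotate (cover g) x).1 i = (rotMatrix g.1).mulVec x.1.ofLp i := rfl
  rw [pauliVec_eq, pauliVec_eq, Matrix.eta_fin_two g.1, h01, h11]
  simp only [hrot, rotMatrix_eq, Matrix.mulVec, dotProduct, Fin.sum_univ_three]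
  generalize g.1 0 0 = a
  generalize g.1 1 0 = c
  ext i k
  fin_cases i <;> fin_cases k <;> apply Complex.ext <;>
    simp [Matrix.mul_apply, Matrix.star_apply, Fin.sum_univ_two, pow_two] <;> ring

lemma spinorForm_eq_dotProduct (p q : ℂ) (x : S2) :
    spinorForm p q x = ![-q, p] ⬝ᵥ (pauliVec x).mulVec ![p, q] := by
  rw [pauliVec_eq, spinorForm]
  simp only [dotProduct, Nat.succ_eq_add_one, Nat.reduceAdd, Matrix.mulVec, Matrix.of_apply,
    Matrix.cons_val', Matrix.cons_val_fin_one, Fin.sum_univ_two, Matrix.cons_val_zero,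
    Matrix.cons_val_one, neg_mul]
  ring

lemma fnRep_apply (g : SU2) (F : S2 → ℂ) (x : S2) :
    fnRep g F x = F (rotate (cover g)⁻¹ x) := rfl

lemma fnRep_spinorForm (g : SU2) (p q : ℂ) :
    fnRep g (spinorForm p q) =
      spinorForm (g.1 0 0 * p + g.1 0 1 * q) (g.1 1 0 * p + g.1 1 1 * q) := by
  obtain ⟨h01, h11, -⟩ := su2_entries g
  have hright : ![g.1 0 0 * p + g.1 0 1 * q, g.1 1 0 * p + g.1 1 1 * q] = g.1.mulVec ![p, q] := by
    ext i
    fin_cases i <;> simp [Matrix.mulVec, dotProduct, Fin.sum_univ_two]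
  have hleft : ![-(g.1 1 0 * p + g.1 1 1 * q), g.1 0 0 * p + g.1 0 1 * q] =
      Matrix.vecMul ![-q, p] (star g.1) := by
    ext i
    fin_cases i <;>
      simp [Matrix.vecMul, dotProduct, Fin.sum_univ_two, Matrix.star_apply, h01, h11] <;> ring
  have hinv : (g⁻¹).1 = star g.1 := rfl
  funext x
  rw [fnRep_apply, ← map_inv, spinorForm_eq_dotProduct, spinorForm_eq_dotProduct, pauliVec_rotate,
    hinv, star_star, hleft, hright, ← Matrix.dotProduct_mulVec, Matrix.mulVec_mulVec,
    Matrix.mulVec_mulVec, Matrix.mul_assoc]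

lemma fnRep_pow (g : SU2) (F : S2 → ℂ) (l : ℕ) : fnRep g (F ^ l) = fnRep g F ^ l := rfl

variable {l : ℕ}

lemma restrictSphere_linearCombination_harmAux_coherent {z : ℂ} (hz : z ≠ 0) (w : ℂ) :
    (restrictSphere.toLinearMap ∘ₗ Fintype.linearCombination ℂ
      fun k : Fin (2 * l + 1) => harmAux l k) (coherent (2 * l) z w) =
      (((-1) ^ l / harmNorm l : ℝ) : ℂ) • spinorForm z w ^ l := by
  rw [LinearMap.comp_apply, linearCombination_harmAux_coherent hz, map_smul]
  congr 1
  refine (map_pow restrictSphere _ l).trans (congrArg (· ^ l) (funext fun x => ?_))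
  simp [restrictSphere_apply, spinorForm, MvPolynomial.smul_eval, mul_add]

/-- The equivariant map from the spin-`l` representation to functions on the sphere which carries
the standard basis to `Y_{l, l}, Y_{l, l - 1}, …, Y_{l, -l}`. -/
def harmEmb (l : ℕ) : (spinRepresentation (2 * l)).IntertwiningMap fnRep :=
  LinearMap.intertwiningMap_of_isIntertwiningMap _ _ _ <| isIntertwiningMap_of_coherent
    (T := restrictSphere.toLinearMap ∘ₗ Fintype.linearCombination ℂ
      fun k : Fin (2 * l + 1) => harmAux l k)
    fun g t hu => by
      rw [restrictSphere_linearCombination_harmAux_coherent one_ne_zero,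
        restrictSphere_linearCombination_harmAux_coherent hu, map_smul, fnRep_pow,
        fnRep_spinorForm, mul_one, mul_one]

lemma harmEmb_single (k : Fin (2 * l + 1)) :
    harmEmb l (Pi.single k 1) = restrictSphere (harmAux l k) :=
  congrArg restrictSphere
    ((Fintype.linearCombination_apply_single ℂ _ k 1).trans (one_smul ℂ _))

lemma harmEmb_coherent_one (t : ℂ) : harmEmb l (coherent (2 * l) 1 t) =
    (((-1) ^ l / harmNorm l : ℝ) : ℂ) • spinorForm 1 t ^ l :=
  restrictSphere_linearCombination_harmAux_coherent one_ne_zero t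

lemma harmNorm_ne_zero : harmNorm l ≠ 0 := by
  unfold harmNorm
  positivity

end Harmonics

/-! ### Equivariant maps to functions on the sphere -/

/-- The north pole `(0, 0, 1)` of the sphere. -/
def northPole : S2 := ⟨EuclideanSpace.single 2 1, by simp⟩

lemma spinorForm_northPole (p q : ℂ) : spinorForm p q northPole = -2 * (p * q) := by
  simp [spinorForm, northPole]

lemma harmEmb_coherent_one_one_northPole (l : ℕ) :
    harmEmb l (coherent (2 * l) 1 1) northPole = (((-1) ^ l / harmNorm l * (-2) ^ l : ℝ) : ℂ) := by
  rw [harmEmb_coherent_one, Pi.smul_apply, Pi.pow_apply, spinorForm_northPole]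
  simp

lemma harmEmb_ne_zero (l : ℕ) : harmEmb l ≠ 0 := by
  intro h
  have h0 := harmEmb_coherent_one_one_northPole l
  rw [h] at h0
  have := harmNorm_ne_zero (l := l)
  exact Complex.ofReal_ne_zero.2 (by positivity) h0.symm

lemma rotate_inv_rotate (R : SO3) (x : S2) : rotate R⁻¹ (rotate R x) = x := by
  have hinv : (R⁻¹).1 * R.1 = 1 := congrArg Subtype.val (inv_mul_cancel R)
  refine Subtype.ext ?_
  simp only [rotate, Matrix.mulVec_mulVec, hinv, Matrix.one_mulVec]

lemma rotate_cover_northPole {g : SU2} {x : S2}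
    (hxy : 2 * (conj (g.1 0 0) * g.1 1 0) = x.1 0 + Complex.I * x.1 1)
    (hz : Complex.normSq (g.1 0 0) - Complex.normSq (g.1 1 0) = x.1 2) :
    rotate (cover g) northPole = x := by
  have hre := congrArg Complex.re hxy
  have him := congrArg Complex.im hxy
  simp only [Complex.normSq_apply] at hz
  simp only [Fin.isValue, Complex.mul_re, Complex.re_ofNat, Complex.conj_re, Complex.conj_im,
    neg_mul, sub_neg_eq_add, Complex.im_ofNat, Complex.mul_im, zero_mul, sub_zero, Complex.add_re,
    Complex.ofReal_re, Complex.I_re, Complex.I_im, Complex.ofReal_im, mul_zero, sub_self, add_zero,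
    Complex.add_im, one_mul, zero_add] at hre him
  have hrot (i : Fin 3) : (rotate (cover g) northPole).1 i =
      (rotMatrix g.1).mulVec northPole.1.ofLp i := rfl
  refine Subtype.ext (PiLp.ext fun i => ?_)
  rw [hrot, rotMatrix_eq]
  fin_cases i <;> simp [northPole, Matrix.mulVec, dotProduct] <;> linarith

lemma exists_hopf_eq (x : S2) : ∃ a c : ℂ, Complex.normSq a + Complex.normSq c = 1 ∧
    2 * (conj a * c) = x.1 0 + Complex.I * x.1 1 ∧
    Complex.normSq a - Complex.normSq c = x.1 2 := by
  set w : ℂ := x.1 0 + Complex.I * x.1 1 with hw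
  have hx : Complex.normSq w = (1 + x.1 2) * (1 - x.1 2) := by
    have h := EuclideanSpace.real_norm_sq_eq x.1
    rw [norm_eq_of_mem_sphere, Fin.sum_univ_three] at h
    rw [hw, mul_comm Complex.I, Complex.normSq_add_mul_I]
    linarith
  obtain hz | hz := eq_or_ne (1 + x.1 2) 0
  · rw [hz, zero_mul, Complex.normSq_eq_zero] at hx
    exact ⟨0, 1, by simp, by simp [hx], by simp; linarith⟩
  · have hpos : 0 < (1 + x.1 2) / 2 := by
      have : 0 ≤ 1 + x.1 2 := by
        by_contra! h
        nlinarith [Complex.normSq_nonneg w]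
      positivity
    set r := √((1 + x.1 2) / 2)
    have hr0 : (r : ℂ) ≠ 0 := Complex.ofReal_ne_zero.2 (Real.sqrt_pos.2 hpos).ne'
    have hr2 : r * r = (1 + x.1 2) / 2 := Real.mul_self_sqrt hpos.le
    have hc : Complex.normSq (w / (2 * r)) = (1 - x.1 2) / 2 := by
      rw [map_div₀, map_mul, hx, Complex.normSq_ofReal, hr2, Complex.normSq_ofNat]
      field_simp
    refine ⟨r, w / (2 * r), ?_, ?_, ?_⟩
    · rw [hc, Complex.normSq_ofReal, hr2]
      ring
    · rw [Complex.conj_ofReal]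
      field_simp
    · rw [hc, Complex.normSq_ofReal, hr2]
      ring

lemma exists_rotate_eq_northPole (x : S2) : ∃ g : SU2, rotate (cover g)⁻¹ x = northPole := by
  obtain ⟨a, c, h, hxy, hz⟩ := exists_hopf_eq x
  refine ⟨su2OfColumn a c h, ?_⟩
  rw [← rotate_cover_northPole (g := su2OfColumn a c h) hxy hz, rotate_inv_rotate]

lemma rotate_torusElt_northPole : rotate (cover torusElt)⁻¹ northPole = northPole := by
  have hfix : rotate (cover torusElt) northPole = northPole :=
    rotate_cover_northPole (by simp [torusElt, su2OfColumn, northPole])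
      (by simp [torusElt, su2OfColumn, northPole, Complex.normSq_eq_norm_sq, Complex.norm_exp])
  conv_lhs => rw [← hfix]
  exact rotate_inv_rotate _ _

/-- The index of the weight-zero vector of the spin-`l` representation. -/
def midIdx (l : ℕ) : Fin (2 * l + 1) := ⟨l, by omega⟩

lemma exp_weight_midIdx (l : ℕ) :
    Complex.exp (((2 * l : ℕ) - 2 * midIdx l : ℤ) * Complex.I) = 1 := by
  simp [midIdx]

lemma spinRepresentation_torusElt_single {N : ℕ} (k : Fin (N + 1)) :
    spinRepresentation N torusElt (Pi.single k 1) =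
      Complex.exp ((N - 2 * k : ℤ) * Complex.I) • Pi.single k 1 := by
  rw [spinRepresentation_apply, spinRep_torusElt, Matrix.diagonal_mulVec_single, ← Pi.single_smul,
    smul_eq_mul]

section Schur

variable {l : ℕ} (f : (spinRepresentation (2 * l)).IntertwiningMap fnRep)

lemma apply_single_northPole_eq_zero {k : Fin (2 * l + 1)} (hk : k ≠ midIdx l) :
    f (Pi.single k 1) northPole = 0 := by
  have h : _ = fnRep torusElt (f (Pi.single k 1)) northPole :=
    congrFun (f.isIntertwining _ _ torusElt (Pi.single k 1)) northPole
  rw [spinRepresentation_torusElt_single, map_smul, fnRep_apply, rotate_torusElt_northPole,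
    Pi.smul_apply, smul_eq_mul, mul_left_eq_self₀] at h
  exact h.resolve_left fun he =>
    hk (exp_weight_injective (2 * l) (he.trans (exp_weight_midIdx l).symm))

lemma apply_northPole (v : Fin (2 * l + 1) → ℂ) :
    f v northPole = v (midIdx l) * f (Pi.single (midIdx l) 1) northPole := by
  conv_lhs => rw [pi_eq_sum_univ' v]
  rw [map_sum, Finset.sum_apply, Finset.sum_eq_single (midIdx l)]
  · rw [map_smul, Pi.smul_apply, smul_eq_mul]
  · intro k _ hk
    rw [map_smul, Pi.smul_apply, apply_single_northPole_eq_zero f hk, smul_zero]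
  · simp

variable {f} in
lemma eq_zero_of_apply_northPole_eq_zero (h : f (Pi.single (midIdx l) 1) northPole = 0) :
    f = 0 := by
  refine Representation.IntertwiningMap.ext (LinearMap.ext fun v => funext fun x => ?_)
  obtain ⟨g, hg⟩ := exists_rotate_eq_northPole x
  have hx : f (spinRepresentation (2 * l) g (spinRepresentation (2 * l) g⁻¹ v)) x =
      fnRep g (f (spinRepresentation (2 * l) g⁻¹ v)) x :=
    congrFun (f.isIntertwining _ _ _ _) x
  rw [Representation.self_inv_apply, fnRep_apply, hg, apply_northPole, h, mul_zero] at hx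
  exact hx

lemma exists_harmEmb_northPole_eq_ofReal (l : ℕ) : ∃ r : ℝ, r ≠ 0 ∧
    harmEmb l (Pi.single (midIdx l) 1) northPole = r := by
  have h := harmEmb_coherent_one_one_northPole l
  rw [apply_northPole, coherent, one_pow, one_pow, mul_one, mul_one, mul_comm,
    ← eq_div_iff (ofReal_sqrt_choose_ne_zero (midIdx l).is_le), ← Complex.ofReal_div] at h
  have := harmNorm_ne_zero (l := l)
  have := Nat.choose_pos (midIdx l).is_le
  exact ⟨_, by positivity, h⟩

variable {f} in
lemma eq_smul_harmEmb {c : ℂ} (h : f (Pi.single (midIdx l) 1) northPole =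
    c * harmEmb l (Pi.single (midIdx l) 1) northPole) : f = c • harmEmb l :=
  sub_eq_zero.1 <| eq_zero_of_apply_northPole_eq_zero <| sub_eq_zero.2 h

end Schur

/-! ### Adjoints, traces and mean values -/

section Hermitian

variable {n l : ℕ}

lemma opRep_conjTranspose (g : SU2) (P : Op n) :
    (opRep n g P).conjTranspose = opRep n g P.conjTranspose := by
  rw [opRep_apply, opRep_apply, Matrix.conjTranspose_mul, Matrix.conjTranspose_mul, spinRep_inv,
    Matrix.conjTranspose_conjTranspose, mul_assoc]

lemma Jminus_map_conj : (Jminus n).map conj = Jminus n := by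
  ext a b
  rw [Matrix.map_apply, Jminus, Matrix.of_apply]
  split_ifs
  · exact Complex.conj_ofReal _
  · exact map_zero _

lemma coupledAux_map_conj (k : ℕ) : (coupledAux n l k).map conj = coupledAux n l k := by
  have smul_map (r : ℝ) (M : Op n) : ((r : ℂ) • M).map conj = (r : ℂ) • M.map conj := by
    rw [Matrix.map_smul _ (r : ℂ) fun a => by rw [smul_eq_mul, map_mul, Complex.conj_ofReal]; rfl]
  induction k with
  | zero =>
    rw [coupledAux, smul_map, Matrix.map_pow, Jplus, Matrix.transpose_map, Jminus_map_conj]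
  | succ k ih =>
    rw [coupledAux, smul_map, Matrix.map_sub _ (map_sub _), Matrix.map_mul, Matrix.map_mul,
      Jminus_map_conj, ih]

lemma isDiag_opEmb_single_midIdx : (opEmb n l (Pi.single (midIdx l) 1)).IsDiag := by
  set E := opEmb n l (Pi.single (midIdx l) 1)
  have hfix : E = opRep n torusElt E := by
    rw [← (opEmb n l).isIntertwining _ _, spinRepresentation_torusElt_single, exp_weight_midIdx,
      one_smul]
  have hcomm : E * spinRep n torusElt = spinRep n torusElt * E := by
    conv_lhs => rw [hfix, opRep_apply]
    rw [mul_assoc, ← map_mul, inv_mul_cancel, map_one, mul_one]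
  intro a b hab
  have h := congrFun (congrFun hcomm a) b
  rw [spinRep_torusElt, Matrix.mul_diagonal, Matrix.diagonal_mul, mul_comm,
    mul_eq_mul_right_iff] at h
  exact h.resolve_left fun he => hab (exp_weight_injective n he.symm)

lemma isHermitian_opEmb_single_midIdx : (opEmb n l (Pi.single (midIdx l) 1)).IsHermitian := by
  refine Matrix.IsHermitian.ext fun a b => ?_
  obtain rfl | hab := eq_or_ne a b
  · rw [opEmb_single]
    exact congrFun (congrFun (coupledAux_map_conj (midIdx l)) a) a
  · rw [isDiag_opEmb_single_midIdx hab, isDiag_opEmb_single_midIdx hab.symm, star_zero]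

end Hermitian

section SurfaceMeasure

open MeasureTheory

/-- The homeomorphism of the unit sphere induced by a linear isometry. -/
def sphereHomeomorph {E : Type*} [NormedAddCommGroup E] [NormedSpace ℝ E] (e : E ≃ₗᵢ[ℝ] E) :
    Metric.sphere (0 : E) 1 ≃ₜ Metric.sphere (0 : E) 1 :=
  e.toHomeomorph.subtype fun x => by simp

open scoped Pointwise in
lemma measurePreserving_sphereHomeomorph {E : Type*} [NormedAddCommGroup E] [NormedSpace ℝ E]
    [MeasurableSpace E] [BorelSpace E] {μ : Measure E} {e : E ≃ₗᵢ[ℝ] E}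
    (he : MeasurePreserving e μ μ) :
    MeasurePreserving (sphereHomeomorph e) μ.toSphere μ.toSphere := by
  refine ⟨(sphereHomeomorph e).measurable, Measure.ext fun s hs => ?_⟩
  have hcone : Set.Ioo (0 : ℝ) 1 • (Subtype.val '' (sphereHomeomorph e ⁻¹' s)) =
      e ⁻¹' (Set.Ioo (0 : ℝ) 1 • (Subtype.val '' s)) := by
    ext v
    constructor
    · rintro ⟨r, hr, _, ⟨x, hx, rfl⟩, rfl⟩
      exact ⟨r, hr, _, ⟨sphereHomeomorph e x, hx, rfl⟩, (map_smul e r x.1).symm⟩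
    · rintro ⟨r, hr, _, ⟨x, hx, rfl⟩, hv⟩
      obtain ⟨y, rfl⟩ := (sphereHomeomorph e).surjective x
      exact ⟨r, hr, _, ⟨y, hx, rfl⟩, e.injective ((map_smul e r y.1).trans hv)⟩
  rw [Measure.map_apply (sphereHomeomorph e).measurable hs,
    Measure.toSphere_apply' _ ((sphereHomeomorph e).measurable hs), Measure.toSphere_apply' _ hs,
    hcone, he.measure_preimage_emb e.toHomeomorph.measurableEmbedding]

/-- The surface measure of the sphere. -/
abbrev sphereMeasure : Measure S2 := (volume : Measure (EuclideanSpace ℝ (Fin 3))).toSphere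

/-- A rotation as a linear isometry of Euclidean space. -/
def rotIsometry (R : SO3) : EuclideanSpace ℝ (Fin 3) ≃ₗᵢ[ℝ] EuclideanSpace ℝ (Fin 3) :=
  Unitary.linearIsometryEquiv ⟨Matrix.toEuclideanCLM (𝕜 := ℝ) R.1,
    Unitary.map_mem _ (Matrix.mem_specialOrthogonalGroup_iff.1 R.2).1⟩

lemma integral_rotate {V : Type*} [NormedAddCommGroup V] [NormedSpace ℝ V] (R : SO3) (F : S2 → V) :
    ∫ x, F (rotate R x) ∂sphereMeasure = ∫ x, F x ∂sphereMeasure :=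
  (measurePreserving_sphereHomeomorph (rotIsometry R).measurePreserving).integral_comp
    (sphereHomeomorph (rotIsometry R)).measurableEmbedding F

lemma sphereMeasure_real_univ : sphereMeasure.real Set.univ = 4 * Real.pi := by
  rw [Measure.toSphere_real_apply_univ, measureReal_def, EuclideanSpace.volume_ball_fin_three,
    finrank_euclideanSpace_fin, ← ENNReal.ofReal_pow zero_le_one,
    ← ENNReal.ofReal_mul (by positivity), ENNReal.toReal_ofReal (by positivity)]
  ring

lemma integrable_of_continuous {F : S2 → ℂ} (hF : Continuous F) : Integrable F sphereMeasure :=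
  hF.integrable_of_hasCompactSupport (HasCompactSupport.of_compactSpace F)

lemma contDiff_eval_ofReal {ι : Type*} [Fintype ι] (p : MvPolynomial ι ℂ) : ContDiff ℝ ∞
    fun v : EuclideanSpace ℝ ι => MvPolynomial.eval (fun i => ((v i : ℝ) : ℂ)) p := by
  induction p using MvPolynomial.induction_on with
  | C a => simpa only [MvPolynomial.eval_C] using contDiff_const
  | add p q hp hq => simpa only [map_add] using hp.add hq
  | mul_X p i hp =>
    have hX : ContDiff ℝ ∞ fun v : EuclideanSpace ℝ ι => ((v i : ℝ) : ℂ) :=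
      Complex.ofRealCLM.contDiff.comp (by fun_prop)
    simpa only [map_mul, MvPolynomial.eval_X] using hp.mul hX

lemma contMDiff_restrictSphere (p : MvPolynomial (Fin 3) ℂ) :
    ContMDiff (𝓡 2) 𝓘(ℝ, ℂ) ∞ (restrictSphere p) := by
  rw [show restrictSphere p = _ from funext (restrictSphere_apply p)]
  exact (contDiff_eval_ofReal p).contMDiff.comp contMDiff_coe_sphere

variable {l : ℕ}

lemma contMDiff_harmEmb (v : Fin (2 * l + 1) → ℂ) :
    ContMDiff (𝓡 2) 𝓘(ℝ, ℂ) ∞ (harmEmb l v) :=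
  contMDiff_restrictSphere (Fintype.linearCombination ℂ (fun k : Fin (2 * l + 1) => harmAux l k) v)

/-- The integral over the sphere, as a functional on a linear family of continuous functions. -/
def integralLin {V : Type*} [AddCommGroup V] [Module ℂ V] (L : V →ₗ[ℂ] (S2 → ℂ))
    (hL : ∀ v, Continuous (L v)) : V →ₗ[ℂ] ℂ where
  toFun v := ∫ x, L v x ∂sphereMeasure
  map_add' v w := by
    simp only [map_add, Pi.add_apply]
    exact integral_add (integrable_of_continuous (hL v)) (integrable_of_continuous (hL w))
  map_smul' c v := by
    simp only [map_smul, Pi.smul_apply, RingHom.id_apply]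
    exact integral_smul c _

lemma eq_zero_of_invariant {N : ℕ} (hN : 0 < N) {φ : (Fin (N + 1) → ℂ) →ₗ[ℂ] ℂ}
    (hφ : ∀ g v, φ (spinRepresentation N g v) = φ v) : φ = 0 := by
  have h := intertwiningMap_eq_zero_of_finrank_lt (by simp [hN])
    (φ.intertwiningMap_of_isIntertwiningMap (spinRepresentation N)
      (Representation.trivial ℂ SU2 ℂ) hφ)
  exact congrArg (·.toLinearMap) h

lemma integral_harmEmb (hl : 0 < l) (v : Fin (2 * l + 1) → ℂ) :
    ∫ x, harmEmb l v x ∂sphereMeasure = 0 := by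
  have h : integralLin (harmEmb l).toLinearMap (fun v => (contMDiff_harmEmb v).continuous) = 0 :=
    eq_zero_of_invariant (by omega) fun g v =>
      (congrArg (fun F : S2 → ℂ => ∫ x, F x ∂sphereMeasure)
        ((harmEmb l).isIntertwining _ _ g v)).trans (integral_rotate _ _)
  exact LinearMap.congr_fun h v

lemma trace_opRep {n : ℕ} (g : SU2) (P : Op n) : (opRep n g P).trace = P.trace := by
  rw [opRep_apply, Matrix.trace_mul_comm, ← mul_assoc, ← map_mul, inv_mul_cancel, map_one, one_mul]

lemma trace_opEmb {n : ℕ} (hl : 0 < l) (v : Fin (2 * l + 1) → ℂ) : (opEmb n l v).trace = 0 := by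
  have h : Matrix.traceLinearMap (Fin (n + 1)) ℂ ℂ ∘ₗ (opEmb n l).toLinearMap = 0 :=
    eq_zero_of_invariant (by omega) fun g v =>
      (congrArg Matrix.trace ((opEmb n l).isIntertwining _ _ g v)).trans (trace_opRep g _)
  exact LinearMap.congr_fun h v

end SurfaceMeasure

/-! ### Decomposition of the operator space -/

section Decomposition

lemma toNat_sub_lt {l : ℕ} {m : ℤ} (hm : |m| ≤ l) : ((l : ℤ) - m).toNat < 2 * l + 1 := by
  rw [abs_le] at hm
  omega

lemma coupled_eq_opEmb (n : ℕ) {l : ℕ} {m : ℤ} (hm : |m| ≤ l) :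
    coupled n l m = opEmb n l (Pi.single ⟨((l : ℤ) - m).toNat, toNat_sub_lt hm⟩ 1) := by
  rw [opEmb_single, coupled]

lemma sphHarm_eq_harmEmb {l : ℕ} {m : ℤ} (hm : |m| ≤ l) :
    sphHarm l m = harmEmb l (Pi.single ⟨((l : ℤ) - m).toNat, toNat_sub_lt hm⟩ 1) := by
  rw [harmEmb_single]
  exact funext fun x => (restrictSphere_apply _ x).symm

lemma span_eq_range {V : Type*} [AddCommGroup V] [Module ℂ V] {l : ℕ}
    {T : (Fin (2 * l + 1) → ℂ) →ₗ[ℂ] V} {v : ℤ → V}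
    (hv : ∀ (m : ℤ) (hm : |m| ≤ l), v m = T (Pi.single ⟨((l : ℤ) - m).toNat, toNat_sub_lt hm⟩ 1)) :
    Submodule.span ℂ {A | ∃ m : ℤ, |m| ≤ l ∧ A = v m} = LinearMap.range T := by
  refine le_antisymm (Submodule.span_le.2 ?_) ?_
  · rintro _ ⟨m, hm, rfl⟩
    exact ⟨_, (hv m hm).symm⟩
  · rintro _ ⟨x, rfl⟩
    rw [pi_eq_sum_univ' x, map_sum]
    refine Submodule.sum_mem _ fun k _ => ?_
    have hk : |(l : ℤ) - k| ≤ l := abs_le.2 (by omega)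
    rw [map_smul]
    refine Submodule.smul_mem _ _ (Submodule.subset_span ⟨(l : ℤ) - k, hk, ?_⟩)
    rw [hv _ hk]
    congr 2
    simp

lemma isIrreducibleSub_range {V W : Type*} [AddCommGroup V] [Module ℂ V] [AddCommGroup W]
    [Module ℂ W] {σ : Representation ℂ SU2 V} {ρ : Representation ℂ SU2 W} [σ.IsIrreducible]
    {f : σ.IntertwiningMap ρ} (hf : f ≠ 0) : IsIrreducibleSub ρ (LinearMap.range f.toLinearMap) :=
  ⟨f.range, rfl, isIrreducible_range_toRepresentation hf⟩

lemma finrank_range_spinRepresentation {N : ℕ} {W : Type*} [AddCommGroup W] [Module ℂ W]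
    {ρ : Representation ℂ SU2 W} {f : (spinRepresentation N).IntertwiningMap ρ} (hf : f ≠ 0) :
    Module.finrank ℂ (LinearMap.range f.toLinearMap) = N + 1 := by
  rw [finrank_range_intertwiningMap hf, Module.finrank_fin_fun]

lemma harmSummand_eq_range (l : ℕ) : harmSummand l = LinearMap.range (harmEmb l).toLinearMap :=
  span_eq_range fun _ hm => sphHarm_eq_harmEmb hm

variable (n : ℕ)

/-- The rescaling `√(n+1) e(l, m)` of the coupled basis, as an embedding of the spin-`l`
representation. In this scaling the weight vector for `l = 0` is the identity operator. -/
def unitEmb (l : ℕ) : (spinRepresentation (2 * l)).IntertwiningMap (opRep n) :=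
  ((√((n : ℝ) + 1) : ℝ) : ℂ) • opEmb n l

lemma ofReal_sqrt_add_one_ne_zero : ((√((n : ℝ) + 1) : ℝ) : ℂ) ≠ 0 :=
  Complex.ofReal_ne_zero.2 (by positivity)

lemma opSummand_eq_range (l : ℕ) : opSummand n l = LinearMap.range (unitEmb n l).toLinearMap :=
  (span_eq_range fun _ hm => coupled_eq_opEmb n hm).trans
    (LinearMap.range_smul _ _ (ofReal_sqrt_add_one_ne_zero n)).symm

lemma smul_coupled_eq_unitEmb {l : ℕ} {m : ℤ} (hm : |m| ≤ l) :
    ((√((n : ℝ) + 1) : ℝ) : ℂ) • coupled n l m =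
      unitEmb n l (Pi.single ⟨((l : ℤ) - m).toNat, toNat_sub_lt hm⟩ 1) :=
  congrArg _ (coupled_eq_opEmb n hm)

lemma unitEmb_zero_single : unitEmb n 0 (Pi.single 0 1) = 1 := by
  have hnorm : opNorm n 0 = √((n : ℝ) + 1) := by simp [opNorm]
  change ((√((n : ℝ) + 1) : ℝ) : ℂ) • opEmb n 0 (Pi.single 0 1) = 1
  rw [opEmb_single, Fin.val_zero, coupledAux, hnorm, pow_zero, pow_zero, smul_smul,
    Complex.ofReal_div, Complex.ofReal_one, mul_one_div_cancel (ofReal_sqrt_add_one_ne_zero n),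
    one_smul]

/-- The direct sum of the spin-`l` representations, `0 ≤ l ≤ n`. -/
abbrev SpinSum : Type := ∀ l : Fin (n + 1), Fin (2 * (l : ℕ) + 1) → ℂ

lemma finrank_spinSum : Module.finrank ℂ (SpinSum n) = Module.finrank ℂ (Op n) := by
  have sum_odd : ∀ N, ∑ l : Fin N, (2 * (l : ℕ) + 1) = N * N := fun N => by
    rw [Fin.sum_univ_eq_sum_range fun l => 2 * l + 1]
    induction N with
    | zero => rfl
    | succ N ih => rw [Finset.sum_range_succ, ih]; ring
  rw [Module.finrank_pi_fintype, Module.finrank_matrix, Fintype.card_fin, Module.finrank_self,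
    mul_one, ← sum_odd]
  exact Finset.sum_congr rfl fun l _ => Module.finrank_fin_fun ℂ

variable {n}

lemma unitEmb_ne_zero {l : ℕ} (hl : l ≤ n) : unitEmb n l ≠ 0 := fun h =>
  opEmb_ne_zero hl <| Representation.IntertwiningMap.ext <| LinearMap.ext fun v =>
    (smul_eq_zero_iff_right (ofReal_sqrt_add_one_ne_zero n)).1 (DFunLike.congr_fun h v)

lemma isHermitian_unitEmb_single_midIdx {l : ℕ} :
    (unitEmb n l (Pi.single (midIdx l) 1)).IsHermitian :=
  isHermitian_opEmb_single_midIdx.smul (Complex.conj_ofReal _)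

lemma trace_unitEmb {l : ℕ} (hl : 0 < l) (v : Fin (2 * l + 1) → ℂ) : (unitEmb n l v).trace = 0 :=
  (Matrix.trace_smul ((√((n : ℝ) + 1) : ℝ) : ℂ) (opEmb n l v)).trans
    (by rw [trace_opEmb hl, smul_zero])

lemma iSupIndep_range_spinRepresentation {W : Type*} [AddCommGroup W] [Module ℂ W]
    {ρ : Representation ℂ SU2 W}
    {f : ∀ l : Fin (n + 1), (spinRepresentation (2 * l)).IntertwiningMap ρ} (hf : ∀ l, f l ≠ 0) :
    iSupIndep fun l => LinearMap.range (f l).toLinearMap :=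
  iSupIndep_range_intertwiningMap (fun i j hij => isEmpty_equiv_of_finrank_ne (by
    simpa [Fin.val_inj] using hij)) hf

lemma lsum_spinRepresentation_injective {W : Type*} [AddCommGroup W] [Module ℂ W]
    {ρ : Representation ℂ SU2 W}
    {f : ∀ l : Fin (n + 1), (spinRepresentation (2 * l)).IntertwiningMap ρ} (hf : ∀ l, f l ≠ 0) :
    Function.Injective (LinearMap.lsum ℂ _ ℂ fun l => (f l).toLinearMap) :=
  lsum_injective_of_iSupIndep (fun l => intertwiningMap_injective_of_ne_zero (hf l))
    (iSupIndep_range_spinRepresentation hf)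

variable (n) in
/-- The decomposition of the operator space into irreducible representations. -/
def opEquiv : SpinSum n ≃ₗ[ℂ] Op n :=
  LinearMap.linearEquivOfInjective (LinearMap.lsum ℂ _ ℂ fun l => (unitEmb n l).toLinearMap)
    (lsum_spinRepresentation_injective fun l => unitEmb_ne_zero l.is_le) (finrank_spinSum n)

lemma opEquiv_single (l : Fin (n + 1)) (v : Fin (2 * (l : ℕ) + 1) → ℂ) :
    opEquiv n (Pi.single l v) = unitEmb n l v :=
  LinearMap.lsum_piSingle ℂ _ ℂ (fun l : Fin (n + 1) => (unitEmb n l).toLinearMap) l v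

lemma op_linearMap_ext {V : Type*} [AddCommGroup V] [Module ℂ V] {f g : Op n →ₗ[ℂ] V}
    (h : ∀ (l : Fin (n + 1)) v, f (unitEmb n l v) = g (unitEmb n l v)) : f = g := by
  have hcomp : f ∘ₗ (opEquiv n).toLinearMap = g ∘ₗ (opEquiv n).toLinearMap :=
    LinearMap.pi_ext fun l v => by
      rw [LinearMap.comp_apply, LinearMap.comp_apply, LinearEquiv.coe_coe, opEquiv_single, h]
  exact (LinearEquiv.eq_comp_toLinearMap_iff f g).1 hcomp

variable (n) in
lemma isInternal_opSummand : DirectSum.IsInternal fun l : Fin (n + 1) => opSummand n l := by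
  simp only [opSummand_eq_range]
  refine DirectSum.isInternal_submodule_of_iSupIndep_of_iSup_eq_top
    (iSupIndep_range_spinRepresentation fun l => unitEmb_ne_zero l.is_le)
    (eq_top_iff.2 fun P _ => ?_)
  obtain ⟨x, rfl⟩ := (opEquiv n).surjective P
  rw [← Finset.univ_sum_single x, map_sum]
  refine Submodule.sum_mem _ fun l _ => Submodule.mem_iSup_of_mem l ?_
  rw [opEquiv_single]
  exact ⟨x l, rfl⟩

end Decomposition

/-! ### Equivariant maps from operators to functions -/

section EquivariantMaps

variable {n : ℕ}

/-- The scalar by which an equivariant map acts on the spin-`l` summand, read off at the north pole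
from the weight-zero vector. -/
def charCoeff (Φ : (opRep n).IntertwiningMap fnRep) (l : ℕ) : ℂ :=
  Φ (unitEmb n l (Pi.single (midIdx l) 1)) northPole / harmEmb l (Pi.single (midIdx l) 1) northPole

lemma apply_unitEmb (Φ : (opRep n).IntertwiningMap fnRep) {l : ℕ} (v : Fin (2 * l + 1) → ℂ) :
    Φ (unitEmb n l v) = charCoeff Φ l • harmEmb l v := by
  obtain ⟨r, hr, hmid⟩ := exists_harmEmb_northPole_eq_ofReal l
  have h : Φ.comp (unitEmb n l) = charCoeff Φ l • harmEmb l := eq_smul_harmEmb <| Eq.symm <|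
    div_mul_cancel₀ _ (hmid.trans_ne (Complex.ofReal_ne_zero.2 hr))
  exact DFunLike.congr_fun h v

lemma intertwiningMap_ext {Φ Ψ : (opRep n).IntertwiningMap fnRep}
    (h : ∀ l : Fin (n + 1), charCoeff Φ l = charCoeff Ψ l) : Φ = Ψ :=
  Representation.IntertwiningMap.ext <| op_linearMap_ext fun l v =>
    (apply_unitEmb Φ v).trans ((h l).symm ▸ (apply_unitEmb Ψ v).symm)

lemma toLinearMap_comp_opEquiv (Φ : (opRep n).IntertwiningMap fnRep) :
    Φ.toLinearMap ∘ₗ (opEquiv n).toLinearMap =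
      LinearMap.lsum ℂ _ ℂ fun l : Fin (n + 1) => (charCoeff Φ l • harmEmb l).toLinearMap :=
  LinearMap.pi_ext fun l v => by
    rw [LinearMap.lsum_piSingle, LinearMap.comp_apply, LinearEquiv.coe_coe, opEquiv_single]
    exact apply_unitEmb Φ v

lemma apply_eq_sum (Φ : (opRep n).IntertwiningMap fnRep) (P : Op n) :
    Φ P = ∑ l : Fin (n + 1), charCoeff Φ l • harmEmb l ((opEquiv n).symm P l) := by
  have h := LinearMap.congr_fun (toLinearMap_comp_opEquiv Φ) ((opEquiv n).symm P)
  rw [LinearMap.comp_apply, LinearEquiv.coe_coe, LinearEquiv.apply_symm_apply,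
    LinearMap.lsum_apply, LinearMap.sum_apply] at h
  exact h

lemma contMDiff_apply (Φ : (opRep n).IntertwiningMap fnRep) (P : Op n) :
    ContMDiff (𝓡 2) 𝓘(ℝ, ℂ) ∞ (Φ P) := by
  have h : Φ P = fun x => ∑ l : Fin (n + 1),
      harmEmb l (charCoeff Φ l • (opEquiv n).symm P l) x := by
    funext x
    rw [apply_eq_sum, Finset.sum_apply]
    simp only [map_smul]
  rw [h]
  exact ContMDiff.sum fun l _ => contMDiff_harmEmb _

lemma injective_iff_charCoeff_ne_zero {Φ : (opRep n).IntertwiningMap fnRep} :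
    Function.Injective Φ ↔ ∀ l : Fin (n + 1), charCoeff Φ l ≠ 0 := by
  refine ⟨fun hΦ l hl => ?_, fun h => ?_⟩
  · refine unitEmb_ne_zero l.is_le <|
      Representation.IntertwiningMap.ext (LinearMap.ext fun v => hΦ ?_)
    exact ((apply_unitEmb Φ v).trans (by rw [hl, zero_smul])).trans (map_zero Φ).symm
  · have hinj : Function.Injective (Φ.toLinearMap ∘ₗ (opEquiv n).toLinearMap) := by
      rw [toLinearMap_comp_opEquiv]
      exact lsum_spinRepresentation_injective fun l => smul_ne_zero (h l) (harmEmb_ne_zero l)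
    exact Function.Injective.of_comp_right hinj (opEquiv n).surjective

section Diagonal

variable (c : Fin (n + 1) → ℂ)

/-- The linear map that sends the spin-`l` summand to the spherical harmonics of degree `l`, with
scalar `c l`. -/
def diagonalLin : Op n →ₗ[ℂ] (S2 → ℂ) :=
  (LinearMap.lsum ℂ _ ℂ fun l => c l • (harmEmb l).toLinearMap) ∘ₗ (opEquiv n).symm.toLinearMap

lemma diagonalLin_unitEmb (l : Fin (n + 1)) (v : Fin (2 * (l : ℕ) + 1) → ℂ) :
    diagonalLin c (unitEmb n l v) = c l • harmEmb l v := by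
  rw [diagonalLin, LinearMap.comp_apply, LinearEquiv.coe_coe, ← opEquiv_single,
    LinearEquiv.symm_apply_apply, LinearMap.lsum_piSingle]
  rfl

lemma diagonalLin_opRep (g : SU2) (P : Op n) :
    diagonalLin c (opRep n g P) = fnRep g (diagonalLin c P) := by
  refine LinearMap.congr_fun (f := diagonalLin c ∘ₗ opRep n g) (g := fnRep g ∘ₗ diagonalLin c)
    (op_linearMap_ext fun l v => ?_) P
  rw [LinearMap.comp_apply, LinearMap.comp_apply, ← (unitEmb n l).isIntertwining _ _,
    diagonalLin_unitEmb, diagonalLin_unitEmb, map_smul, ← (harmEmb l).isIntertwining _ _]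

/-- `diagonalLin` as a map of representations. -/
def diagonalMap : (opRep n).IntertwiningMap fnRep :=
  (diagonalLin c).intertwiningMap_of_isIntertwiningMap _ _ (diagonalLin_opRep c)

lemma charCoeff_diagonalMap (l : Fin (n + 1)) : charCoeff (diagonalMap c) l = c l := by
  obtain ⟨r, hr, hmid⟩ := exists_harmEmb_northPole_eq_ofReal l
  have h : diagonalMap c (unitEmb n l (Pi.single (midIdx l) 1)) northPole = c l * _ :=
    congrFun (diagonalLin_unitEmb c l (Pi.single (midIdx l) 1)) northPole
  rw [charCoeff, h, mul_div_cancel_right₀ _ (hmid.trans_ne (Complex.ofReal_ne_zero.2 hr))]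

end Diagonal

section Reality

/-- The conjugate `P ↦ conj (Φ P*)` of an equivariant map. -/
def conjMap (Φ : (opRep n).IntertwiningMap fnRep) : (opRep n).IntertwiningMap fnRep where
  toFun P := star (Φ P.conjTranspose)
  map_add' P Q := by rw [Matrix.conjTranspose_add, map_add, star_add]
  map_smul' a P := by
    rw [Matrix.conjTranspose_smul, map_smul, star_smul, star_star, RingHom.id_apply]
  isIntertwining' g := LinearMap.ext fun P =>
    (congrArg (fun Q => star (Φ Q)) (opRep_conjTranspose g P)).trans
      (congrArg star (Φ.isIntertwining _ _ g P.conjTranspose))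

lemma charCoeff_conjMap (Φ : (opRep n).IntertwiningMap fnRep) (l : ℕ) :
    charCoeff (conjMap Φ) l = conj (charCoeff Φ l) := by
  obtain ⟨r, -, hmid⟩ := exists_harmEmb_northPole_eq_ofReal l
  have h : conjMap Φ (unitEmb n l (Pi.single (midIdx l) 1)) northPole =
      conj (Φ (unitEmb n l (Pi.single (midIdx l) 1)) northPole) :=
    congrArg (fun Q => conj (Φ Q northPole)) isHermitian_unitEmb_single_midIdx
  rw [charCoeff, charCoeff, h, hmid, map_div₀, Complex.conj_ofReal]

lemma apply_conjTranspose_iff {Φ : (opRep n).IntertwiningMap fnRep} :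
    (∀ P x, Φ P.conjTranspose x = conj (Φ P x)) ↔
      ∀ l : Fin (n + 1), conj (charCoeff Φ l) = charCoeff Φ l := by
  simp only [← charCoeff_conjMap]
  refine ⟨fun h l => congrArg (charCoeff · l) (DFunLike.ext _ _ fun P => funext fun x => ?_),
    fun h P x => ?_⟩
  · exact (congrArg conj (h P x)).trans (Complex.conj_conj _)
  · have hx : conj (Φ P.conjTranspose x) = Φ P x :=
      congrFun (DFunLike.congr_fun (intertwiningMap_ext h) P) x
    rw [← hx, Complex.conj_conj]

end Reality

section MeanValue

lemma harmEmb_zero_single : harmEmb 0 (Pi.single 0 1) = 1 := by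
  rw [harmEmb_single, Fin.val_zero, harmAux, harmNorm]
  simp

lemma eq_smul_single_zero (v : Fin (2 * 0 + 1) → ℂ) : v = v 0 • Pi.single 0 1 :=
  funext fun i => by
    rw [Subsingleton.elim (α := Fin 1) i 0, Pi.smul_apply, Pi.single_eq_same, smul_eq_mul, mul_one]

lemma mean_harmEmb_zero (v : Fin (2 * 0 + 1) → ℂ) :
    (1 / (4 * Real.pi) : ℂ) * ∫ x, harmEmb 0 v x ∂sphereMeasure = v 0 := by
  have hpi : (Real.pi : ℂ) ≠ 0 := Complex.ofReal_ne_zero.2 Real.pi_ne_zero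
  have hv : harmEmb 0 v = fun _ => v 0 := by
    rw [eq_smul_single_zero v, map_smul, harmEmb_zero_single]
    exact funext fun _ => by simp
  simp only [hv, MeasureTheory.integral_const, sphereMeasure_real_univ, Complex.real_smul,
    Complex.ofReal_mul, Complex.ofReal_ofNat]
  field_simp

variable (n) in
lemma one_div_mul_trace_one : (1 / (n + 1) : ℂ) * (1 : Op n).trace = 1 := by
  rw [Matrix.trace_one, Fintype.card_fin, Nat.cast_succ, one_div_mul_cancel n.cast_add_one_ne_zero]

lemma trace_unitEmb_zero (v : Fin (2 * 0 + 1) → ℂ) :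
    (1 / (n + 1) : ℂ) * (unitEmb n 0 v).trace = v 0 := by
  conv_lhs => rw [eq_smul_single_zero v, map_smul, unitEmb_zero_single, Matrix.trace_smul,
    mul_smul_comm, one_div_mul_trace_one, smul_eq_mul, mul_one]

lemma mean_apply (Φ : (opRep n).IntertwiningMap fnRep) (P : Op n) :
    (1 / (4 * Real.pi) : ℂ) * ∫ x, Φ P x ∂sphereMeasure =
      charCoeff Φ 0 * ((1 / (n + 1) : ℂ) * P.trace) := by
  refine LinearMap.congr_fun
    (f := (1 / (4 * Real.pi) : ℂ) •
      integralLin Φ.toLinearMap fun P => (contMDiff_apply Φ P).continuous)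
    (g := charCoeff Φ 0 • (1 / (n + 1) : ℂ) • Matrix.traceLinearMap _ ℂ ℂ)
    (op_linearMap_ext fun l v => ?_) P
  change (1 / (4 * Real.pi) : ℂ) * ∫ x, Φ (unitEmb n l v) x ∂sphereMeasure =
    charCoeff Φ 0 * ((1 / (n + 1) : ℂ) * (unitEmb n l v).trace)
  rw [apply_unitEmb]
  simp only [Pi.smul_apply]
  rw [MeasureTheory.integral_smul]
  obtain rfl | hl := eq_zero_or_pos l
  · exact (mul_left_comm _ _ _).trans
      (congrArg _ ((mean_harmEmb_zero v).trans (trace_unitEmb_zero v).symm))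
  · rw [integral_harmEmb hl, trace_unitEmb hl, smul_zero, mul_zero, mul_zero, mul_zero]

lemma mean_eq_trace_iff {Φ : (opRep n).IntertwiningMap fnRep} :
    (∀ P, (1 / (4 * Real.pi) : ℂ) * ∫ x, Φ P x ∂sphereMeasure = (1 / (n + 1) : ℂ) * P.trace) ↔
      charCoeff Φ 0 = 1 := by
  simp only [mean_apply]
  refine ⟨fun h => ?_, fun h P => by rw [h, one_mul]⟩
  simpa only [one_div_mul_trace_one, mul_one] using h 1

end MeanValue

end EquivariantMaps

section Moduli

variable {n : ℕ}

/-- A symbol correspondence as a map of representations. -/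
def equivariantMap (W : SymbolCorrespondence n) : (opRep n).IntertwiningMap fnRep :=
  W.toLin.intertwiningMap_of_isIntertwiningMap _ _ W.equivariant

lemma symbolCorrespondence_ext {W W' : SymbolCorrespondence n}
    (h : equivariantMap W = equivariantMap W') : W = W' := by
  cases W
  cases W'
  cases congrArg (·.toLinearMap) h
  rfl

lemma ofReal_re_charCoeff (W : SymbolCorrespondence n) (l : Fin (n + 1)) :
    ((charCoeff (equivariantMap W) l).re : ℂ) = charCoeff (equivariantMap W) l :=
  Complex.conj_eq_iff_re.1 (apply_conjTranspose_iff.1 W.real l)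

/-- The characteristic numbers `c₁, …, cₙ` of a symbol correspondence. -/
def charNumbers (W : SymbolCorrespondence n) (i : Fin n) : ℝˣ :=
  Units.mk0 (charCoeff (equivariantMap W) i.succ).re <| Complex.ofReal_ne_zero.1 <|
    (ofReal_re_charCoeff W i.succ).trans_ne (injective_iff_charCoeff_ne_zero.1 W.injective i.succ)

/-- The characteristic numbers completed by `c₀ = 1`. -/
def consOne (c : Fin n → ℝˣ) : Fin (n + 1) → ℝ := Fin.cons 1 fun i => (c i : ℝ)

lemma consOne_ne_zero (c : Fin n → ℝˣ) (l : Fin (n + 1)) : consOne c l ≠ 0 :=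
  Fin.cases one_ne_zero (fun i => (c i).ne_zero) l

lemma consOne_charNumbers (W : SymbolCorrespondence n) (l : Fin (n + 1)) :
    (consOne (charNumbers W) l : ℂ) = charCoeff (equivariantMap W) l := by
  refine Fin.cases ?_ (fun i => ofReal_re_charCoeff W i.succ) l
  exact (mean_eq_trace_iff.1 W.normalized).symm

/-- The symbol correspondence with characteristic numbers `c₁, …, cₙ`. -/
def symbolOf (c : Fin n → ℝˣ) : SymbolCorrespondence n where
  toLin := diagonalLin fun l => (consOne c l : ℂ)
  smooth := contMDiff_apply (diagonalMap _)
  injective := injective_iff_charCoeff_ne_zero (Φ := diagonalMap _).2 fun l => by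
    rw [charCoeff_diagonalMap]
    exact Complex.ofReal_ne_zero.2 (consOne_ne_zero c l)
  equivariant := diagonalLin_opRep _
  real := apply_conjTranspose_iff (Φ := diagonalMap _).2 fun l => by
    rw [charCoeff_diagonalMap, Complex.conj_ofReal]
  normalized := mean_eq_trace_iff (Φ := diagonalMap _).2 (charCoeff_diagonalMap _ 0)

lemma charCoeff_symbolOf (c : Fin n → ℝˣ) (l : Fin (n + 1)) :
    charCoeff (equivariantMap (symbolOf c)) l = consOne c l :=
  charCoeff_diagonalMap _ l

lemma symbolOf_charNumbers (W : SymbolCorrespondence n) : symbolOf (charNumbers W) = W :=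
  symbolCorrespondence_ext <| intertwiningMap_ext fun l =>
    (charCoeff_symbolOf _ l).trans (consOne_charNumbers W l)

lemma charNumbers_symbolOf (c : Fin n → ℝˣ) : charNumbers (symbolOf c) = c :=
  funext fun i => Units.ext <| (congrArg Complex.re (charCoeff_symbolOf c i.succ)).trans
    (Complex.ofReal_re _)

lemma continuous_toLin_apply (P : Op n) (x : S2) :
    Continuous fun W : SymbolCorrespondence n => W.toLin P x :=
  (continuous_apply x).comp ((continuous_apply P).comp continuous_induced_dom)

lemma continuous_charNumbers : Continuous (charNumbers (n := n)) :=
  continuous_pi fun _ => Units.isEmbedding_val₀.continuous_iff.2 <|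
    Complex.continuous_re.comp ((continuous_toLin_apply _ _).div_const _)

lemma continuous_consOne : Continuous (consOne (n := n)) :=
  continuous_pi <| Fin.cases continuous_const fun i =>
    Units.continuous_val.comp (continuous_apply i)

lemma continuous_symbolOf : Continuous (symbolOf (n := n)) := by
  refine continuous_induced_rng.2 (continuous_pi fun P => continuous_pi fun x => ?_)
  have h (c : Fin n → ℝˣ) : (symbolOf c).toLin P x =
      ∑ l : Fin (n + 1), (consOne c l : ℂ) * harmEmb l ((opEquiv n).symm P l) x := by
    refine (congrFun (apply_eq_sum (equivariantMap (symbolOf c)) P) x).trans ?_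
    simp only [Finset.sum_apply, Pi.smul_apply, smul_eq_mul, charCoeff_symbolOf]
  refine Continuous.congr ?_ fun c => (h c).symm
  exact continuous_finsetSum _ fun l _ => (Complex.continuous_ofReal.comp
    ((continuous_apply l).comp continuous_consOne)).mul continuous_const

variable (n) in
/-- The moduli space of symbol correspondences. -/
def moduliHomeomorph : SymbolCorrespondence n ≃ₜ (Fin n → ℝˣ) where
  toFun := charNumbers
  invFun := symbolOf
  left_inv := symbolOf_charNumbers
  right_inv := charNumbers_symbolOf
  continuous_toFun := continuous_charNumbers
  continuous_invFun := continuous_symbolOf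

lemma toLin_smul_coupled (W : SymbolCorrespondence n) (l : Fin (n + 1)) {m : ℤ}
    (hm : |m| ≤ (l : ℕ)) :
    W.toLin (((√((n : ℝ) + 1) : ℝ) : ℂ) • coupled n l m) =
      (consOne (charNumbers W) l : ℂ) • sphHarm l m := by
  rw [smul_coupled_eq_unitEmb n hm, sphHarm_eq_harmEmb hm, consOne_charNumbers]
  exact apply_unitEmb (equivariantMap W) _

end Moduli

end SpinSystem

end

open SpinSystem in
theorem mainTheorem1 (n : ℕ) :
    DirectSum.IsInternal (fun l : Fin (n + 1) => opSummand n l) ∧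
    (∀ l : ℕ, l ≤ n →
      IsIrreducibleSub (opRep n) (opSummand n l) ∧ IsIrreducibleSub fnRep (harmSummand l) ∧
      Module.finrank ℂ (opSummand n l) = 2 * l + 1 ∧
      Module.finrank ℂ (harmSummand l) = 2 * l + 1) ∧
    ∃ Φ : SymbolCorrespondence n ≃ₜ (Fin n → ℝˣ),
      ∀ (W : SymbolCorrespondence n) (l : Fin (n + 1)) (m : ℤ), |m| ≤ (l : ℕ) →
        W.toLin (((√((n : ℝ) + 1) : ℝ) : ℂ) • coupled n l m) =
          (((Fin.cons 1 (fun i => (Φ W i : ℝ)) : Fin (n + 1) → ℝ) l : ℝ) : ℂ) •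
            sphHarm l m := by
  refine ⟨isInternal_opSummand n, fun l hl => ?_, moduliHomeomorph n,
    fun W l _ hm => toLin_smul_coupled W l hm⟩
  rw [opSummand_eq_range, harmSummand_eq_range]
  exact ⟨isIrreducibleSub_range (unitEmb_ne_zero hl), isIrreducibleSub_range (harmEmb_ne_zero l),
    finrank_range_spinRepresentation (unitEmb_ne_zero hl),
    finrank_range_spinRepresentation (harmEmb_ne_zero l)⟩
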